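/- Let $c,d\ge 1$ be integers, let $G=\langle a,b : ab^c=b^da\rangle$ be the Baumslag--Solitar group, let $P\subset G$ be the submonoid generated by $a$ and $b$, and let $\theta:G\to\mathbb Z$ be the homomorphism with $\theta(a)=1$, $\theta(b)=0$. Order $G$ by $g\le h\iff g^{-1}h\in P$; the pair $(G,P)$ is quasi-lattice ordered. Let $C^*(G,P)$ be the universal unital $C^*$-algebra generated by a Nica-covariant isometric representation $T:P\to C^*(G,P)$, that is, a homomorphism of monoids with $T_x^*T_x=1$ and $T_xT_x^*T_yT_y^*=T_{x\vee y}T_{x\vee y}^*$ if $x,y$ have a common upper bound in $P$ (with least upper bound $x\vee y$), and $T_xT_x^*T_yT_y^*=0$ otherwise. Let $\alpha:\mathbb R\to\operatorname{Aut}C^*(G,P)$ be the dynamics with $\alpha_s(T_x)=e^{is\theta(x)}T_x$. A state $\phi$ is a KMS$_\beta$ state of $(C^*(G,P),\alpha)$ if $\phi(xy)=\phi(y\,\alpha_{i\beta}(x))$ for all $\alpha$-analytic elements $x$ and all $y$. Suppose that $\beta>\ln d$. A KMS$_\beta$ state is determined by its values on the elements $T_{b^t}$, $t\in\mathbb N=\{0,1,2,\dots\}$.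 For every Borel probability measure $\mu$ on $\mathbb T$ there is a (hence unique) KMS$_\beta$ state $\psi_{\beta,\mu}$ such that for all $t\in\mathbb N$ $$\psi_{\beta,\mu}(T_{b^t})=(1-e^{-\beta}d)\Big(\int_{\mathbb T}z^t\,d\mu(z)+\sum_{\{k\ge 1\,:\,d\,\mid\,c^jd^{-j}t\text{ for }0\le j<k\}}e^{-\beta k}d^k\int_{\mathbb T}z^{c^kd^{-k}t}\,d\mu(z)\Big),$$ where "$d\mid c^jd^{-j}t$" means that the rational number $c^jd^{-j}t$ is an integer multiple of $d$, the sum converges absolutely, and it is $0$ if there are no such $k$. Every KMS$_\beta$ state is of the form $\psi_{\beta,\mu}$ for some $\mu$. If $d$ does not divide $c$, then $\mu\mapsto\psi_{\beta,\mu}$ is an affine homeomorphism of the simplex $P(\mathbb T)$ of Borel probability measures on $\mathbb T$ onto the set of KMS$_\beta$ states of $(C^*(G,P),\alpha)$, for the weak* topologies. -/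

import Mathlib

open scoped ENNReal NNReal ComplexOrder
open MeasureTheory

namespace BaumslagSolitar

noncomputable section

/-! ### The Baumslag–Solitar group and its positive cone -/

/-- The two generators. -/
inductive Gen
  | a
  | b

/-- The single relator `a b^c (b^d a)⁻¹`. -/
def relator (c d : ℕ) : FreeGroup Gen :=
  FreeGroup.of Gen.a * FreeGroup.of Gen.b ^ c *
    (FreeGroup.of Gen.b ^ d * FreeGroup.of Gen.a)⁻¹

/-- `BS(c,d) = ⟨a, b : a b^c = b^d a⟩`. -/
abbrev BS (c d : ℕ) : Type := PresentedGroup ({relator c d} : Set (FreeGroup Gen))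

/-- The generator `a` of the group. -/
def gA (c d : ℕ) : BS c d := PresentedGroup.of Gen.a

/-- The generator `b` of the group. -/
def gB (c d : ℕ) : BS c d := PresentedGroup.of Gen.b

/-- The submonoid `P` generated by `a` and `b`. -/
def cone (c d : ℕ) : Submonoid (BS c d) := Submonoid.closure {gA c d, gB c d}

/-- The generator `b` as an element of `P`. -/
def bP (c d : ℕ) : cone c d :=
  ⟨gB c d, Submonoid.subset_closure (Set.mem_insert_of_mem _ rfl)⟩

/-- The height homomorphism on generators: `a ↦ 1`, `b ↦ 0`. -/
def heightGen : Gen → Multiplicative ℤ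
  | Gen.a => Multiplicative.ofAdd 1
  | Gen.b => 1

/-- The height homomorphism `θ : G → ℤ` (with `ℤ` written multiplicatively). -/
def heightHom (c d : ℕ) : BS c d →* Multiplicative ℤ :=
  PresentedGroup.toGroup (f := heightGen) (by
    intro r hr
    rw [Set.mem_singleton_iff] at hr
    subst hr
    simp [relator, heightGen])

/-- The height `θ(g) ∈ ℤ`. -/
def height {c d : ℕ} (g : BS c d) : ℤ := Multiplicative.toAdd (heightHom c d g)

/-- The left-invariant order: `g ≤ h` iff `g⁻¹ h ∈ P`. -/
def Le {c d : ℕ} (g h : BS c d) : Prop := g⁻¹ * h ∈ cone c d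

/-- `z` is a common upper bound in `P` of `x` and `y`. -/
def IsUpper {c d : ℕ} (x y z : cone c d) : Prop :=
  Le (x : BS c d) (z : BS c d) ∧ Le (y : BS c d) (z : BS c d)

/-- `z` is the least upper bound `x ∨ y` in `P`. -/
def IsJoin {c d : ℕ} (x y z : cone c d) : Prop :=
  IsUpper x y z ∧ ∀ w : cone c d, IsUpper x y w → Le (z : BS c d) (w : BS c d)

/-! ### Nica-covariant representations and the universal `C*`-algebra -/

/-- A Nica-covariant isometric representation of `P` in a unital `C*`-algebra:
a monoid homomorphism into the isometries with
`S_x S_x^* S_y S_y^* = S_{x ∨ y} S_{x ∨ y}^*` if `x ∨ y < ∞`, and `= 0` if `x ∨ y = ∞`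
(`x` and `y` have no common upper bound). As `(G,P)` is quasi-lattice ordered for `c, d ≥ 1`,
a pair with a common upper bound has a least one. -/
structure IsNicaCovariant {c d : ℕ} {B : Type*} [CStarAlgebra B] (S : cone c d →* B) :
    Prop where
  isometry : ∀ x, star (S x) * S x = 1
  join : ∀ x y z, IsJoin x y z →
    (S x * star (S x)) * (S y * star (S y)) = S z * star (S z)
  disjoint : ∀ x y, (¬ ∃ z, IsUpper x y z) →
    (S x * star (S x)) * (S y * star (S y)) = 0

/-- A Nica-covariant representation of `P` in some nonzero unital `C*`-algebra. Since `P` is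
countable, every `C*`-algebra generated by such a representation has at most continuum
cardinality, so it is enough to look at algebras in `Type`. -/
structure NicaRep (c d : ℕ) : Type 1 where
  B : Type
  [cstar : CStarAlgebra B]
  [nontriv : Nontrivial B]
  S : cone c d →* B
  nica : IsNicaCovariant S

attribute [instance] NicaRep.cstar NicaRep.nontriv

/-- The `ℓ^∞`-direct product of the targets of all Nica-covariant representations. -/
abbrev Big (c d : ℕ) : Type 1 := lp (fun r : NicaRep c d => r.B) ∞

instance instCStarAlgebraBig (c d : ℕ) : CStarAlgebra (Big c d) where
  toCompleteSpace := inferInstance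

theorem IsNicaCovariant.norm_le {c d : ℕ} {B : Type*} [CStarAlgebra B] [Nontrivial B]
    {S : cone c d →* B} (hS : IsNicaCovariant S) (x : cone c d) : ‖S x‖ ≤ 1 := by
  have h := CStarRing.norm_star_mul_self (x := S x)
  rw [hS.isometry, norm_one] at h
  nlinarith [norm_nonneg (S x)]

/-- The direct product `x ↦ (S_x)_S` of all Nica-covariant representations. -/
def bigRep (c d : ℕ) : cone c d →* Big c d where
  toFun x := ⟨fun r => r.S x, memℓp_infty ⟨1, by
    rintro _ ⟨r, rfl⟩
    exact r.nica.norm_le x⟩⟩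
  map_one' := by
    apply lp.ext
    funext r
    exact map_one r.S
  map_mul' x y := by
    apply lp.ext
    funext r
    exact map_mul r.S x y

/-- The closed `*`-subalgebra generated by the direct product representation. -/
def toeplitz (c d : ℕ) : StarSubalgebra ℂ (Big c d) :=
  (StarAlgebra.adjoin ℂ (Set.range (bigRep c d))).topologicalClosure

instance isClosed_toeplitz (c d : ℕ) : IsClosed (toeplitz c d : Set (Big c d)) :=
  StarSubalgebra.isClosed_topologicalClosure _

/-- The `C*`-algebra `C*(G,P)`, generated by a universal Nica-covariant representation of `P`
(see `T_isNicaCovariant` and `exists_unique_lift`). -/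
def CStarGP (c d : ℕ) : Type 1 := toeplitz c d

instance instCStarAlgebraCStarGP (c d : ℕ) : CStarAlgebra (CStarGP c d) :=
  StarSubalgebra.cstarAlgebra (toeplitz c d)

/-- The inclusion of `C*(G,P)` in the product. -/
def incl (c d : ℕ) : CStarGP c d →⋆ₐ[ℂ] Big c d := (toeplitz c d).subtype

theorem incl_injective (c d : ℕ) : Function.Injective (incl c d) := Subtype.val_injective

theorem bigRep_mem (c d : ℕ) (x : cone c d) : bigRep c d x ∈ toeplitz c d :=
  StarSubalgebra.le_topologicalClosure _ (StarAlgebra.subset_adjoin ℂ _ ⟨x, rfl⟩)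

/-- The universal Nica-covariant representation `x ↦ T_x`. -/
def T (c d : ℕ) : cone c d →* CStarGP c d where
  toFun x := ⟨bigRep c d x, bigRep_mem c d x⟩
  map_one' := Subtype.ext (map_one (bigRep c d))
  map_mul' x y := Subtype.ext (map_mul (bigRep c d) x y)

theorem T_isNicaCovariant (c d : ℕ) : IsNicaCovariant (T c d) where
  isometry x := by
    apply Subtype.ext
    apply lp.ext
    funext r
    exact r.nica.isometry x
  join x y z h := by
    apply Subtype.ext
    apply lp.ext
    funext r
    exact r.nica.join x y z h
  disjoint x y h := by
    apply Subtype.ext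
    apply lp.ext
    funext r
    exact r.nica.disjoint x y h

/-- Evaluation of an element of the product at one representation. -/
def evalHom {c d : ℕ} (r : NicaRep c d) : Big c d →⋆ₐ[ℂ] r.B where
  toFun f := f r
  map_one' := rfl
  map_mul' _ _ := rfl
  map_zero' := rfl
  map_add' _ _ := rfl
  commutes' _ := rfl
  map_star' _ := rfl

/-- The `*`-homomorphisms on `C*(G,P)` are determined by their values on the `T_x`. -/
theorem hom_ext {c d : ℕ} {B : Type*} [CStarAlgebra B] {f g : CStarGP c d →⋆ₐ[ℂ] B}
    (h : ∀ x, f (T c d x) = g (T c d x)) : f = g := by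
  have hf : Continuous f :=
    AddMonoidHomClass.continuous_of_bound f 1 fun x => by
      simpa only [one_mul] using NonUnitalStarAlgHom.norm_apply_le f x
  have hg : Continuous g :=
    AddMonoidHomClass.continuous_of_bound g 1 fun x => by
      simpa only [one_mul] using NonUnitalStarAlgHom.norm_apply_le g x
  have key := StarAlgHom.ext_topologicalClosure (R := ℂ) (A := Big c d) (B := B)
    (S := StarAlgebra.adjoin ℂ (Set.range (bigRep c d))) (φ := f) (ψ := g) hf hg
  refine key ?_
  refine StarAlgHom.ext_adjoin ?_
  rintro ⟨_, hx⟩ ⟨x, rfl⟩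
  exact h x

/-- The universal property of `C*(G,P)`. -/
theorem exists_unique_lift {c d : ℕ} {B : Type} [CStarAlgebra B] [Nontrivial B]
    (S : cone c d →* B) (hS : IsNicaCovariant S) :
    ∃! f : CStarGP c d →⋆ₐ[ℂ] B, ∀ x, f (T c d x) = S x := by
  refine ⟨(evalHom ⟨B, S, hS⟩).comp (incl c d), fun x => rfl, ?_⟩
  intro g hg
  exact hom_ext fun x => hg x

/-! ### The gauge action and the dynamics -/

/-- The representation `x ↦ z^{θ(x)} S_x`. -/
def twistHom {c d : ℕ} {B : Type*} [CStarAlgebra B] (S : cone c d →* B) (z : Circle) :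
    cone c d →* B where
  toFun x := ((z ^ height (x : BS c d) : Circle) : ℂ) • S x
  map_one' := by simp [height]
  map_mul' x y := by
    simp only [height, Submonoid.coe_mul, map_mul, toAdd_mul, zpow_add, Circle.coe_mul,
      smul_mul_smul_comm]

theorem circle_smul_star {B : Type*} [CStarAlgebra B] (w : Circle) (s : B) :
    ((w : ℂ) • s) * star ((w : ℂ) • s) = s * star s := by
  rw [star_smul, smul_mul_smul_comm, Complex.star_def, Complex.mul_conj]
  simp

theorem circle_star_smul {B : Type*} [CStarAlgebra B] (w : Circle) (s : B) :
    star ((w : ℂ) • s) * ((w : ℂ) • s) = star s * s := by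
  rw [star_smul, smul_mul_smul_comm, Complex.star_def, mul_comm, Complex.mul_conj]
  simp

theorem IsNicaCovariant.twist {c d : ℕ} {B : Type*} [CStarAlgebra B] {S : cone c d →* B}
    (hS : IsNicaCovariant S) (z : Circle) : IsNicaCovariant (twistHom S z) where
  isometry x := (circle_star_smul _ _).trans (hS.isometry x)
  join x y z h := by
    simp only [twistHom, MonoidHom.coe_mk, OneHom.coe_mk, circle_smul_star]
    exact hS.join x y z h
  disjoint x y h := by
    simp only [twistHom, MonoidHom.coe_mk, OneHom.coe_mk, circle_smul_star]
    exact hS.disjoint x y h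

/-- Twisting a Nica-covariant representation by `z ∈ 𝕋` through the height map. -/
abbrev NicaRep.twist {c d : ℕ} (r : NicaRep c d) (z : Circle) : NicaRep c d where
  B := r.B
  S := twistHom r.S z
  nica := r.nica.twist z

/-- The gauge automorphism on the product: precomposition with twisting of representations. -/
def bigGauge (c d : ℕ) (z : Circle) : Big c d →⋆ₐ[ℂ] Big c d where
  toFun f := ⟨fun r => f (r.twist z), memℓp_infty ⟨‖f‖, by
    rintro _ ⟨r, rfl⟩
    exact lp.norm_apply_le_norm ENNReal.top_ne_zero f (r.twist z)⟩⟩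
  map_one' := rfl
  map_mul' _ _ := rfl
  map_zero' := rfl
  map_add' _ _ := rfl
  commutes' _ := rfl
  map_star' _ := rfl

theorem bigGauge_bigRep (c d : ℕ) (z : Circle) (x : cone c d) :
    bigGauge c d z (bigRep c d x) =
      ((z ^ height (x : BS c d) : Circle) : ℂ) • bigRep c d x := rfl

theorem bigGauge_mem (c d : ℕ) (z : Circle) {f : Big c d} (hf : f ∈ toeplitz c d) :
    bigGauge c d z f ∈ toeplitz c d := by
  have h1 : StarAlgebra.adjoin ℂ (Set.range (bigRep c d)) ≤
      (toeplitz c d).comap (bigGauge c d z) := by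
    refine StarAlgebra.adjoin_le ?_
    rintro _ ⟨x, rfl⟩
    change bigGauge c d z (bigRep c d x) ∈ toeplitz c d
    rw [bigGauge_bigRep]
    exact (toeplitz c d).smul_mem (bigRep_mem c d x) _
  have h2 : IsClosed (((toeplitz c d).comap (bigGauge c d z) : StarSubalgebra ℂ (Big c d)) :
      Set (Big c d)) :=
    (isClosed_toeplitz c d).preimage
      (AddMonoidHomClass.continuous_of_bound (bigGauge c d z) 1 fun f => by
        rw [one_mul]
        exact lp.norm_le_of_forall_le (norm_nonneg f) fun r =>
          lp.norm_apply_le_norm ENNReal.top_ne_zero f (r.twist z))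
  exact StarSubalgebra.topologicalClosure_minimal h1 h2 hf

/-- The endomorphism `γ_z` of `C*(G,P)` with `γ_z(T_x) = z^{θ(x)} T_x`. -/
def gaugeHom (c d : ℕ) (z : Circle) : CStarGP c d →⋆ₐ[ℂ] CStarGP c d :=
  ((bigGauge c d z).comp (incl c d)).codRestrict (toeplitz c d)
    fun f => bigGauge_mem c d z f.2

theorem gaugeHom_T (c d : ℕ) (z : Circle) (x : cone c d) :
    gaugeHom c d z (T c d x) = ((z ^ height (x : BS c d) : Circle) : ℂ) • T c d x := rfl

theorem gaugeHom_comp (c d : ℕ) (z w : Circle) :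
    (gaugeHom c d z).comp (gaugeHom c d w) = gaugeHom c d (z * w) := by
  refine hom_ext fun x => ?_
  rw [StarAlgHom.comp_apply, gaugeHom_T, map_smul, gaugeHom_T, gaugeHom_T, smul_smul, mul_zpow,
    Circle.coe_mul, mul_comm]

theorem gaugeHom_one (c d : ℕ) : gaugeHom c d 1 = StarAlgHom.id ℂ (CStarGP c d) := by
  refine hom_ext fun x => ?_
  rw [gaugeHom_T]
  simp

/-- The gauge automorphism `γ_z` of `C*(G,P)`. -/
def gauge (c d : ℕ) (z : Circle) : CStarGP c d ≃⋆ₐ[ℂ] CStarGP c d :=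
  StarAlgEquiv.ofStarAlgHom (gaugeHom c d z) (gaugeHom c d z⁻¹)
    (by rw [gaugeHom_comp, inv_mul_cancel, gaugeHom_one])
    (by rw [gaugeHom_comp, mul_inv_cancel, gaugeHom_one])

/-- The dynamics `α_t = γ_{e^{it}}`, so that `α_t(T_x) = e^{itθ(x)} T_x`. -/
def dynamics (c d : ℕ) (t : ℝ) : CStarGP c d ≃⋆ₐ[ℂ] CStarGP c d := gauge c d (Circle.exp t)

theorem dynamics_T (c d : ℕ) (t : ℝ) (x : cone c d) :
    dynamics c d t (T c d x) =
      Complex.exp (Complex.I * t * (height (x : BS c d) : ℤ)) • T c d x := by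
  have h : dynamics c d t (T c d x) =
      ((Circle.exp t ^ height (x : BS c d) : Circle) : ℂ) • T c d x :=
    gaugeHom_T c d (Circle.exp t) x
  rw [h, Circle.coe_zpow, Circle.coe_exp, ← Complex.exp_int_mul]
  congr 2
  ring

/-! ### States and the KMS condition -/

/-- `φ` is a state: positive and unital. -/
def IsState {A : Type*} [CStarAlgebra A] (φ : WeakDual ℂ A) : Prop :=
  (∀ x : A, 0 ≤ φ (star x * x)) ∧ φ 1 = 1

/-- The KMS condition at inverse temperature `β`. An element `x` is analytic if `t ↦ α_t(x)`
extends to an entire function `F`, whose value at `z` is `α_z(x)`; the condition is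
`φ(x y) = φ(y α_{iβ}(x))` for all analytic `x` and all `y`. -/
def IsKMS {A : Type*} [CStarAlgebra A] (α : ℝ → A ≃⋆ₐ[ℂ] A) (β : ℝ) (φ : WeakDual ℂ A) : Prop :=
  IsState φ ∧
    ∀ (x y : A) (F : ℂ → A), Differentiable ℂ F → (∀ t : ℝ, F t = α t x) →
      φ (x * y) = φ (y * F (Complex.I * β))

/-- The set of KMS states of `(C*(G,P), α)` at inverse temperature `β`, with the weak-star
topology. -/
abbrev KMSStates (c d : ℕ) (β : ℝ) : Type 1 :=
  {φ : WeakDual ℂ (CStarGP c d) // IsKMS (dynamics c d) β φ}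

/-! ### Measures on the circle and the moment formula -/

instance instMeasurableSpaceCircle : MeasurableSpace Circle := borel Circle

instance instBorelSpaceCircle : BorelSpace Circle := ⟨rfl⟩

/-- The moment `∫ z^n dμ(z)`. -/
def moment (μ : ProbabilityMeasure Circle) (n : ℕ) : ℂ :=
  ∫ z : Circle, (z : ℂ) ^ n ∂(μ : Measure Circle)

/-- The set of `k ≥ 1` such that `d` divides `c^j d^{-j} t` for `0 ≤ j < k`
(that is, the rational number `c^j d^{-j} t` is an integer multiple of `d`). -/
def indexSet (c d t : ℕ) : Set ℕ :=
  {k | 1 ≤ k ∧ ∀ j < k, ∃ m : ℤ, (c : ℚ) ^ j * ((d : ℚ) ^ j)⁻¹ * t = d * m}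

/-- The `k`-th summand `e^{-βk} d^k ∫ z^{c^k d^{-k} t} dμ(z)`. For `k ∈ indexSet c d t` the
natural number division in the exponent is exact. -/
def momentTerm (c d : ℕ) (β : ℝ) (μ : ProbabilityMeasure Circle) (t k : ℕ) : ℂ :=
  Real.exp (-β * k) * (d : ℂ) ^ k * moment μ (c ^ k * t / d ^ k)

end

end BaumslagSolitar

namespace BaumslagSolitar

noncomputable section

/-! ### Normal forms in the Baumslag–Solitar group -/

/-! Let `stem c w` be b^{i₀} a b^{i₁} a ⋯ for a word w with letters in {0,…,d-1}. Pushing powers of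
b to the right through b^{dq} a = a b^{cq} writes every element of P as stem(w) b^m with m ≥ 0, and
Britton's lemma for the HNN extension of ℤ makes this form unique (`stem_mul_zpow_inj`). Order
questions become questions about prefixes and signs of exponents: bounded pairs have joins, stems of
equal length and different words are unbounded, and the monomials T_x T_y^* span a dense
*-subalgebra.

On that span the KMS condition amounts to φ(T_x X) = e^{-βθ(x)} φ(X T_x). This kills φ(T_x T_y^*)
when the heights differ, and otherwise reduces it to φ(T_y^* T_x), which is 0, some φ(T_{b^t}), or
the conjugate of one. So the numbers φ(T_{b^t}) determine φ (`IsTwistedTrace.ext`).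

Let Q = 1 - ∑_{i<d} T_{b^i a} T_{b^i a}^*. The twisted trace property gives φ(T_{b^t}) = φ(T_{b^t}
Q) + [d ∣ t] e^{-β} d φ(T_{b^{ct/d}}). As e^{-β} d < 1, this recursion has only one bounded
solution, and iterating it produces the series of the theorem (`IsTwistedTrace.apply_pow_eq`).
Moreover t ↦ φ(T_{b^t} Q) is positive definite with value 1 - e^{-β} d at 0, so Herglotz' theorem
(`exists_moment_eq`) makes it a multiple of the moment sequence of some μ. Every KMS state therefore
comes from a measure.

Conversely, for z on the circle, P acts on ℓ² of the words: x·stem(w) = stem(v) b^m gives e_w ↦ z^m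
e_v. The density e^{-β|w|} defines a Gibbs state φ_z, and ∫ φ_z dμ(z) is the required KMS state. In
this representation Q is the projection onto the empty word, so φ_z(T_{b^t} Q) = (1 - e^{-β} d) z^t
(`pointState_pow_mul_defect`). The state thus remembers all moments of μ, and the parametrization is
a continuous bijection from a compact space to a Hausdorff one. -/

theorem gA_mul_gB_pow (c d : ℕ) : gA c d * gB c d ^ c = gB c d ^ d * gA c d := by
  have h : PresentedGroup.mk ({relator c d} : Set (FreeGroup Gen)) (relator c d) = 1 :=
    PresentedGroup.one_of_mem rfl
  rw [relator] at h
  exact mul_inv_eq_one.1 h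

theorem gA_mul_gB_zpow (c d : ℕ) (q : ℤ) :
    gB c d ^ ((d : ℤ) * q) * gA c d = gA c d * gB c d ^ ((c : ℤ) * q) := by
  have h : SemiconjBy (gA c d) (gB c d ^ c) (gB c d ^ d) := gA_mul_gB_pow c d
  have := h.zpow_right q
  rw [zpow_mul, zpow_mul, zpow_natCast, zpow_natCast]
  exact this.eq.symm

@[simp] theorem height_gA (c d : ℕ) : height (gA c d) = 1 := by
  simp [height, heightHom, gA, heightGen]

@[simp] theorem height_gB (c d : ℕ) : height (gB c d) = 0 := by
  simp [height, heightHom, gB, heightGen]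

@[simp] theorem height_one (c d : ℕ) : height (1 : BS c d) = 0 := by simp [height]

@[simp] theorem height_mul {c d : ℕ} (x y : BS c d) : height (x * y) = height x + height y := by
  simp [height]

@[simp] theorem height_zpow {c d : ℕ} (x : BS c d) (n : ℤ) : height (x ^ n) = n * height x := by
  simp [height]

@[simp] theorem height_pow {c d : ℕ} (x : BS c d) (n : ℕ) : height (x ^ n) = n * height x := by
  simp [height]

/-- The element `b^{i₀} a b^{i₁} a ⋯ b^{iₖ} a` attached to the word `i₀ i₁ ⋯ iₖ`. -/
def stem (c : ℕ) {d : ℕ} : List (Fin d) → BS c d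
  | [] => 1
  | i :: w => gB c d ^ (i : ℕ) * gA c d * stem c w

@[simp] theorem stem_nil (c d : ℕ) : stem c ([] : List (Fin d)) = 1 := rfl

theorem stem_cons (c : ℕ) {d : ℕ} (i : Fin d) (w : List (Fin d)) :
    stem c (i :: w) = gB c d ^ (i : ℕ) * gA c d * stem c w := rfl

theorem stem_append (c : ℕ) {d : ℕ} (v w : List (Fin d)) :
    stem c (v ++ w) = stem c v * stem c w := by
  induction v with
  | nil => simp
  | cons i v ih => simp [stem_cons, ih, mul_assoc]

@[simp] theorem height_stem (c : ℕ) {d : ℕ} (w : List (Fin d)) :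
    height (stem c w) = w.length := by
  induction w with
  | nil => simp
  | cons i w ih => simp [stem_cons, ih]; ring

theorem gA_mem_cone (c d : ℕ) : gA c d ∈ cone c d :=
  Submonoid.subset_closure (Set.mem_insert _ _)

theorem gB_mem_cone (c d : ℕ) : gB c d ∈ cone c d :=
  Submonoid.subset_closure (Set.mem_insert_of_mem _ rfl)

theorem gB_zpow_mem_cone (c d : ℕ) {n : ℤ} (hn : 0 ≤ n) : gB c d ^ n ∈ cone c d := by
  lift n to ℕ using hn
  rw [zpow_natCast]
  exact pow_mem (gB_mem_cone c d) n

theorem stem_mem_cone (c : ℕ) {d : ℕ} (w : List (Fin d)) : stem c w ∈ cone c d := by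
  induction w with
  | nil => exact one_mem _
  | cons i w ih =>
    exact mul_mem (mul_mem (pow_mem (gB_mem_cone c d) _) (gA_mem_cone c d)) ih

/-- Powers of `b` permute the stems of a given length, up to a power of `b` on the right. -/
theorem exists_gB_zpow_mul_stem (c : ℕ) {d : ℕ} (w : List (Fin d)) (n : ℤ) :
    ∃ (v : List (Fin d)) (m : ℤ), v.length = w.length ∧ (0 ≤ n → 0 ≤ m) ∧
      gB c d ^ n * stem c w = stem c v * gB c d ^ m := by
  induction w generalizing n with
  | nil => exact ⟨[], n, rfl, id, by simp⟩
  | cons i w ih =>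
    have hd : 0 < d := i.pos
    have hd' : (0 : ℤ) < d := by exact_mod_cast hd
    -- Odometer step: with n + i = r + dq, the remainder r is the new letter, and b^{dq} a = a
    -- b^{cq} carries cq into the rest of the word.
    obtain ⟨v, m, hv, hm, h⟩ := ih ((c : ℤ) * ((n + i) / d))
    have hr : 0 ≤ (n + i) % d := Int.emod_nonneg _ hd'.ne'
    have hr' : (n + i) % d < d := Int.emod_lt_of_pos _ hd'
    refine ⟨⟨((n + i) % d).toNat, by omega⟩ :: v, m, by simp [hv], fun hn => hm ?_, ?_⟩
    · have : 0 ≤ (n + i) / d := Int.ediv_nonneg (by omega) hd'.le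
      positivity
    · have key : gB c d ^ n * gB c d ^ (i : ℕ) =
          gB c d ^ ((n + i) % d).toNat * gB c d ^ ((d : ℤ) * ((n + i) / d)) := by
        rw [← zpow_natCast, ← zpow_natCast, ← zpow_add, ← zpow_add, Int.toNat_of_nonneg hr,
          Int.emod_add_mul_ediv]
      calc gB c d ^ n * stem c (i :: w)
          = (gB c d ^ n * gB c d ^ (i : ℕ)) * gA c d * stem c w := by
            simp only [stem_cons, mul_assoc]
        _ = gB c d ^ ((n + i) % d).toNat * (gB c d ^ ((d : ℤ) * ((n + i) / d)) * gA c d) *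
              stem c w := by rw [key]; simp only [mul_assoc]
        _ = gB c d ^ ((n + i) % d).toNat * gA c d *
              (gB c d ^ ((c : ℤ) * ((n + i) / d)) * stem c w) := by
            rw [gA_mul_gB_zpow]; simp only [mul_assoc]
        _ = _ := by rw [h, stem_cons]; simp only [mul_assoc]

/-- On stems, a prepends the letter 0 and b acts as an odometer whose carries stay nonnegative;
induction over the generators covers all of P. This action on words later becomes the Hilbert space
representation. -/
theorem exists_cone_mul_stem {c d : ℕ} (hd : 0 < d) {x : BS c d} (hx : x ∈ cone c d)
    (w : List (Fin d)) :
    ∃ (v : List (Fin d)) (m : ℤ), (v.length : ℤ) = w.length + height x ∧ 0 ≤ m ∧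
      x * stem c w = stem c v * gB c d ^ m := by
  induction hx using Submonoid.closure_induction generalizing w with
  | mem x hx =>
    rcases hx with rfl | rfl
    · exact ⟨⟨0, hd⟩ :: w, 0, by simp, le_rfl, by simp [stem_cons]⟩
    · obtain ⟨v, m, hv, hm, h⟩ := exists_gB_zpow_mul_stem c w 1
      exact ⟨v, m, by simp [hv], hm zero_le_one, by simpa using h⟩
  | one => exact ⟨w, 0, by simp, le_rfl, by simp⟩
  | mul x y _ _ hx hy =>
    obtain ⟨v, m, hv, hm, h⟩ := hy w
    obtain ⟨u, n, hu, hn, h'⟩ := hx v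
    refine ⟨u, n + m, by rw [hu, hv, height_mul]; ring, by positivity, ?_⟩
    rw [mul_assoc, h, ← mul_assoc, h', zpow_add, mul_assoc]

theorem exists_eq_stem_mul {c d : ℕ} (hd : 0 < d) {x : BS c d} (hx : x ∈ cone c d) :
    ∃ (v : List (Fin d)) (m : ℤ), (v.length : ℤ) = height x ∧ 0 ≤ m ∧
      x = stem c v * gB c d ^ m := by
  obtain ⟨v, m, hv, hm, h⟩ := exists_cone_mul_stem hd hx []
  exact ⟨v, m, by simpa using hv, hm, by simpa using h⟩

/-! The group is an HNN extension of `ℤ`, and Britton's lemma gives uniqueness of normal forms. -/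

theorem powMonoidHom_int_injective {n : ℕ} (hn : 0 < n) :
    Function.Injective (powMonoidHom n : Multiplicative ℤ →* Multiplicative ℤ) := by
  intro x y h
  have h' : (n : ℤ) * Multiplicative.toAdd x = n * Multiplicative.toAdd y := by
    simpa [powMonoidHom_apply] using congrArg Multiplicative.toAdd h
  have hn' : (n : ℤ) ≠ 0 := by exact_mod_cast hn.ne'
  exact Multiplicative.toAdd.injective (mul_left_cancel₀ hn' h')

/-- The isomorphism `cℤ ≃ dℤ` taking `c` to `d`. -/
def baseEquiv {c d : ℕ} (hc : 0 < c) (hd : 0 < d) :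
    (powMonoidHom c : Multiplicative ℤ →* Multiplicative ℤ).range ≃*
      (powMonoidHom d : Multiplicative ℤ →* Multiplicative ℤ).range :=
  (MonoidHom.ofInjective (powMonoidHom_int_injective hc)).symm.trans
    (MonoidHom.ofInjective (powMonoidHom_int_injective hd))

/-- `BS(c,d)` as an HNN extension of `ℤ`. -/
abbrev HNN {c d : ℕ} (hc : 0 < c) (hd : 0 < d) : Type :=
  HNNExtension (Multiplicative ℤ) _ _ (baseEquiv hc hd)

/-- The images of the generators in the HNN extension. -/
def toHNNGen {c d : ℕ} (hc : 0 < c) (hd : 0 < d) : Gen → HNN hc hd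
  | Gen.a => HNNExtension.t
  | Gen.b => HNNExtension.of (Multiplicative.ofAdd 1)

theorem hnn_relation {c d : ℕ} (hc : 0 < c) (hd : 0 < d) :
    (HNNExtension.t : HNN hc hd) * HNNExtension.of (Multiplicative.ofAdd 1) ^ c =
      HNNExtension.of (Multiplicative.ofAdd 1) ^ d * HNNExtension.t := by
  have h := HNNExtension.t_mul_of (φ := baseEquiv hc hd)
    (MonoidHom.ofInjective (powMonoidHom_int_injective hc) (Multiplicative.ofAdd 1))
  have e : baseEquiv hc hd
      (MonoidHom.ofInjective (powMonoidHom_int_injective hc) (Multiplicative.ofAdd 1)) =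
      MonoidHom.ofInjective (powMonoidHom_int_injective hd) (Multiplicative.ofAdd 1) := by
    rw [baseEquiv, MulEquiv.trans_apply, MulEquiv.symm_apply_apply]
  rw [e, MonoidHom.ofInjective_apply, MonoidHom.ofInjective_apply, powMonoidHom_apply,
    powMonoidHom_apply, map_pow, map_pow] at h
  exact h

/-- The homomorphism from the presented group to the HNN extension. -/
def toHNN {c d : ℕ} (hc : 0 < c) (hd : 0 < d) : BS c d →* HNN hc hd :=
  PresentedGroup.toGroup (f := toHNNGen hc hd) (by
    intro r hr
    rw [Set.mem_singleton_iff] at hr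
    subst hr
    simp only [relator, map_mul, map_inv, map_pow, FreeGroup.lift_apply_of, toHNNGen]
    rw [hnn_relation, mul_inv_cancel])

theorem toHNN_gA {c d : ℕ} (hc : 0 < c) (hd : 0 < d) :
    toHNN hc hd (gA c d) = HNNExtension.t := by
  simp [toHNN, gA, toHNNGen]

theorem toHNN_gB {c d : ℕ} (hc : 0 < c) (hd : 0 < d) :
    toHNN hc hd (gB c d) = HNNExtension.of (Multiplicative.ofAdd 1) := by
  simp [toHNN, gB, toHNNGen]

/-- The leading power of `b` in the word `stem w * b^m`. -/
def normalHead {d : ℕ} (m : ℤ) : List (Fin d) → Multiplicative ℤ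
  | [] => Multiplicative.ofAdd m
  | i :: _ => Multiplicative.ofAdd ((i : ℕ) : ℤ)

/-- The letters of the word `stem w * b^m` after the leading power of `b`. -/
def normalTail {d : ℕ} (m : ℤ) : List (Fin d) → List (ℤˣ × Multiplicative ℤ)
  | [] => []
  | _ :: w => (1, normalHead m w) :: normalTail m w

theorem toHNN_gB_zpow {c d : ℕ} (hc : 0 < c) (hd : 0 < d) (m : ℤ) :
    toHNN hc hd (gB c d ^ m) = HNNExtension.of (Multiplicative.ofAdd m) := by
  rw [map_zpow, toHNN_gB, ← map_zpow (HNNExtension.of), ← ofAdd_zsmul, smul_eq_mul, mul_one]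

theorem normalTail_fst {d : ℕ} (m : ℤ) (w : List (Fin d)) :
    ∀ p ∈ normalTail m w, p.1 = 1 := by
  induction w with
  | nil => simp [normalTail]
  | cons i w ih => simpa [normalTail] using ih

/-- The reduced word `stem w * b^m` of the HNN extension. -/
def reducedWord (A B : Subgroup (Multiplicative ℤ)) {d : ℕ} (w : List (Fin d)) (m : ℤ) :
    HNNExtension.NormalWord.ReducedWord (Multiplicative ℤ) A B where
  head := normalHead m w
  toList := normalTail m w
  -- All stable letters occur with exponent 1, so no pinch can occur and the word is reduced
  -- whatever lies between them.
  chain := by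
    refine List.Pairwise.isChain (List.Pairwise.imp_of_mem (R := fun _ _ => True) ?_ ?_)
    · intro p q hp hq _ _
      rw [normalTail_fst m w p hp, normalTail_fst m w q hq]
    · exact List.pairwise_of_forall fun _ _ => trivial

theorem prod_reducedWord {c d : ℕ} (hc : 0 < c) (hd : 0 < d) (w : List (Fin d)) (m : ℤ) :
    (reducedWord _ _ w m).prod (baseEquiv hc hd) = toHNN hc hd (stem c w * gB c d ^ m) := by
  induction w with
  | nil =>
    simp [HNNExtension.NormalWord.ReducedWord.prod, reducedWord, normalHead, normalTail,
      toHNN_gB_zpow]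
  | cons i w ih =>
    rw [stem_cons, mul_assoc, map_mul, ← ih, map_mul, toHNN_gA, map_pow, toHNN_gB]
    simp [HNNExtension.NormalWord.ReducedWord.prod, reducedWord, normalHead, normalTail,
      ← map_pow, ← ofAdd_nsmul, mul_assoc]

/-- Heights force equal lengths. Britton's lemma makes the leading powers of b agree modulo d, hence
agree since letters lie in [0,d); cancelling the first letter leaves a shorter instance. -/
theorem stem_mul_zpow_inj {c d : ℕ} (hc : 0 < c) (hd : 0 < d) {v w : List (Fin d)} {m n : ℤ}
    (h : stem c v * gB c d ^ m = stem c w * gB c d ^ n) : v = w ∧ m = n := by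
  induction v generalizing w with
  | nil =>
    have hl := congrArg height h
    simp only [height_mul, height_stem, height_zpow, height_gB, mul_zero, add_zero] at hl
    obtain rfl : w = [] := by
      rw [← List.length_eq_zero_iff]; exact_mod_cast hl.symm
    refine ⟨rfl, ?_⟩
    have h' := congrArg (toHNN hc hd) h
    simp only [stem_nil, one_mul, toHNN_gB_zpow] at h'
    exact Multiplicative.ofAdd.injective (HNNExtension.of_injective _ h')
  | cons i v ih =>
    have hl := congrArg height h
    simp only [height_mul, height_stem, height_zpow, height_gB, mul_zero, add_zero] at hl
    cases w with
    | nil => simp at hl; omega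
    | cons j w =>
      have h' := congrArg (toHNN hc hd) h
      rw [← prod_reducedWord, ← prod_reducedWord] at h'
      -- The first stable letter has exponent 1, so the two leading powers of b differ by an element
      -- of the subgroup dℤ.
      have h2 := (HNNExtension.ReducedWord.map_fst_eq_and_of_prod_eq _ h').2 1
        (by simp [reducedWord, normalTail])
      simp only [reducedWord, normalHead] at h2
      obtain ⟨q, hq⟩ := h2
      have hq' : (d : ℤ) * Multiplicative.toAdd q = -((i : ℕ) : ℤ) + ((j : ℕ) : ℤ) := by
        simpa [powMonoidHom_apply] using congrArg Multiplicative.toAdd hq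
      have hij : (i : ℕ) = j := by
        have h1 : ((i : ℕ) : ℤ) % d = ((j : ℕ) : ℤ) % d :=
          (Int.modEq_iff_dvd).2 ⟨Multiplicative.toAdd q, by linarith⟩
        rw [← Int.natCast_mod, ← Int.natCast_mod, Nat.mod_eq_of_lt i.2,
          Nat.mod_eq_of_lt j.2] at h1
        exact_mod_cast h1
      obtain rfl : i = j := Fin.ext hij
      simp only [stem_cons, mul_assoc, mul_right_inj] at h
      obtain ⟨rfl, rfl⟩ := ih h
      exact ⟨rfl, rfl⟩

/-- Reduces each order relation to the sign of one exponent. -/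
theorem stem_mul_zpow_mem_cone_iff {c d : ℕ} (hc : 0 < c) (hd : 0 < d) {w : List (Fin d)}
    {m : ℤ} : stem c w * gB c d ^ m ∈ cone c d ↔ 0 ≤ m := by
  constructor
  · intro h
    obtain ⟨v, n, -, hn, h⟩ := exists_eq_stem_mul hd h
    rwa [(stem_mul_zpow_inj hc hd h).2]
  · exact fun h => mul_mem (stem_mem_cone c w) (gB_zpow_mem_cone c d h)

/-! ### Least upper bounds -/

theorem IsUpper.symm {c d : ℕ} {x y z : cone c d} (h : IsUpper x y z) : IsUpper y x z :=
  ⟨h.2, h.1⟩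

theorem IsJoin.symm {c d : ℕ} {x y z : cone c d} (h : IsJoin x y z) : IsJoin y x z :=
  ⟨h.1.symm, fun w hw => h.2 w hw.symm⟩

/-- An upper bound of `stem w * b^m` in the cone extends the word `w`. -/
theorem exists_append_of_le {c d : ℕ} (hc : 0 < c) (hd : 0 < d) {w v : List (Fin d)} {m k : ℤ}
    (h : Le (stem c w * gB c d ^ m) (stem c v * gB c d ^ k)) : ∃ u, v = w ++ u := by
  obtain ⟨p, l, -, -, hp⟩ := exists_eq_stem_mul hd h
  obtain ⟨p', l', -, -, hp'⟩ := exists_gB_zpow_mul_stem c p m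
  refine ⟨p', (stem_mul_zpow_inj hc hd (m := k) (n := l' + l) ?_).1⟩
  rw [inv_mul_eq_iff_eq_mul] at hp
  rw [hp, stem_append, zpow_add]
  simp only [mul_assoc]
  rw [← mul_assoc (gB c d ^ m), hp']
  simp only [mul_assoc]

/-- A common upper bound makes w a prefix of w' = wu. Writing b^{-m} stem(u) = stem(u') b^s, the
element stem(w') b^N lies above y iff N ≥ n and above x iff N ≥ -s. The join is therefore stem(w')
b^{max(n,-s)}. -/
theorem exists_isJoin_of_length_le {c d : ℕ} (hc : 0 < c) (hd : 0 < d) {x y z : cone c d}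
    {w w' : List (Fin d)} {m n : ℤ} (hx : (x : BS c d) = stem c w * gB c d ^ m)
    (hy : (y : BS c d) = stem c w' * gB c d ^ n) (hl : w.length ≤ w'.length)
    (hz : IsUpper x y z) : ∃ j, IsJoin x y j := by
  obtain ⟨v, k, -, -, hv⟩ := exists_eq_stem_mul hd z.2
  obtain ⟨u₁, hu₁⟩ := exists_append_of_le hc hd (hx ▸ hv ▸ hz.1)
  obtain ⟨u₂, hu₂⟩ := exists_append_of_le hc hd (hy ▸ hv ▸ hz.2)
  obtain ⟨u, rfl⟩ : w <+: w' := List.prefix_of_prefix_length_le ⟨u₁, hu₁.symm⟩ ⟨u₂, hu₂.symm⟩ hl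
  obtain ⟨u', s, -, -, hs⟩ := exists_gB_zpow_mul_stem c u (-m)
  have hn : 0 ≤ n := by
    rw [← stem_mul_zpow_mem_cone_iff hc hd (w := w ++ u), ← hy]
    exact y.2
  rw [stem_append] at hy
  have hxj : ∀ g : BS c d, (x : BS c d)⁻¹ * (stem c w * (stem c u * g)) =
      stem c u' * (gB c d ^ s * g) := by
    intro g
    rw [hx, mul_inv_rev, ← zpow_neg, mul_assoc, inv_mul_cancel_left, ← mul_assoc, hs, mul_assoc]
  refine ⟨⟨stem c w * (stem c u * gB c d ^ max n (-s)), mul_mem (stem_mem_cone c w)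
    (mul_mem (stem_mem_cone c u) (gB_zpow_mem_cone c d (hn.trans (le_max_left _ _))))⟩,
    ⟨?_, ?_⟩, ?_⟩
  · change _ * _ ∈ cone c d
    rw [hxj, ← zpow_add, stem_mul_zpow_mem_cone_iff hc hd]
    have := le_max_right n (-s)
    omega
  · change (y : BS c d)⁻¹ * (stem c w * (stem c u * gB c d ^ max n (-s))) ∈ cone c d
    rw [hy, mul_inv_rev, ← zpow_neg, ← mul_assoc (stem c w), mul_assoc, inv_mul_cancel_left,
      ← zpow_add]
    exact gB_zpow_mem_cone c d (by have := le_max_left n (-s); omega)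
  · rintro t ⟨h1, h2⟩
    obtain ⟨p, r, -, hr, hp⟩ := exists_eq_stem_mul hd h2
    rw [inv_mul_eq_iff_eq_mul, hy] at hp
    change _ * _ ∈ cone c d
    have e : ∀ N : ℤ, (stem c w * (stem c u * gB c d ^ N))⁻¹ * (t : BS c d) =
        gB c d ^ (n - N) * (stem c p * gB c d ^ r) := by
      intro N
      rw [hp, inv_mul_eq_iff_eq_mul]
      simp only [mul_assoc]
      rw [← mul_assoc (gB c d ^ N), ← zpow_add, add_sub_cancel]
    rw [Subtype.coe_mk, e]
    rcases le_total (-s) n with h | h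
    · rw [max_eq_left h, sub_self, zpow_zero, one_mul, stem_mul_zpow_mem_cone_iff hc hd]
      exact hr
    · rw [max_eq_right h, sub_neg_eq_add]
      -- Here the bound from x is the binding one. Both join⁻¹t and x⁻¹t end in b^{r'+r} in normal
      -- form, so membership of the latter in P gives membership of the former.
      obtain ⟨p', r', -, -, hp'⟩ := exists_gB_zpow_mul_stem c p (n + s)
      rw [← mul_assoc, hp', mul_assoc, ← zpow_add, stem_mul_zpow_mem_cone_iff hc hd,
        ← stem_mul_zpow_mem_cone_iff hc hd (w := u' ++ p')]
      have h1' : (x : BS c d)⁻¹ * t ∈ cone c d := h1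
      rw [hp, mul_assoc, mul_assoc, hxj, ← mul_assoc (gB c d ^ s), ← zpow_add,
        ← mul_assoc (gB c d ^ _),
        add_comm s n, hp'] at h1'
      rw [stem_append, zpow_add]
      simpa only [mul_assoc] using h1'

/-- `(G,P)` is quasi-lattice ordered: bounded pairs in `P` have joins. -/
theorem exists_isJoin {c d : ℕ} (hc : 0 < c) (hd : 0 < d) {x y z : cone c d}
    (hz : IsUpper x y z) : ∃ j, IsJoin x y j := by
  obtain ⟨w, m, -, -, hx⟩ := exists_eq_stem_mul hd x.2
  obtain ⟨w', n, -, -, hy⟩ := exists_eq_stem_mul hd y.2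
  rcases le_total w.length w'.length with h | h
  · exact exists_isJoin_of_length_le hc hd hx hy h hz
  · obtain ⟨j, hj⟩ := exists_isJoin_of_length_le hc hd hy hx h hz.symm
    exact ⟨j, hj.symm⟩

/-! ### Monomials in `C*(G,P)` -/

/-- The generator `a` as an element of `P`. -/
def aP (c d : ℕ) : cone c d := ⟨gA c d, gA_mem_cone c d⟩

/-- A stem as an element of `P`. -/
def stemP (c : ℕ) {d : ℕ} (w : List (Fin d)) : cone c d := ⟨stem c w, stem_mem_cone c w⟩

theorem exists_eq_stemP_mul {c d : ℕ} (hd : 0 < d) (x : cone c d) :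
    ∃ (w : List (Fin d)) (m : ℕ), (w.length : ℤ) = height (x : BS c d) ∧
      x = stemP c w * bP c d ^ m := by
  obtain ⟨w, m, hw, hm, h⟩ := exists_eq_stem_mul hd x.2
  lift m to ℕ using hm
  exact ⟨w, m, hw, Subtype.ext (by simpa [stemP, bP] using h)⟩

/-- The word of an upper bound would have both v and w as prefixes, and prefixes of equal length
coincide. All orthogonality relations below come from this. -/
theorem not_exists_isUpper_of_stem_ne {c d : ℕ} (hc : 0 < c) (hd : 0 < d)
    {v w : List (Fin d)} (hl : v.length = w.length) (hvw : v ≠ w) (m n : ℕ) :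
    ¬ ∃ z, IsUpper (stemP c v * bP c d ^ m) (stemP c w * bP c d ^ n) z := by
  rintro ⟨z, h1, h2⟩
  obtain ⟨u, k, -, -, hu⟩ := exists_eq_stem_mul hd z.2
  rw [hu] at h1 h2
  obtain ⟨p, hp⟩ := exists_append_of_le hc hd (w := v) (m := m) (by simpa [stemP, bP] using h1)
  obtain ⟨q, hq⟩ := exists_append_of_le hc hd (w := w) (m := n) (by simpa [stemP, bP] using h2)
  exact hvw (List.append_inj_left (hp.symm.trans hq) hl)

/-- Inserting the range projections makes Nica covariance applicable to S_x^* S_y. -/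
theorem IsNicaCovariant.star_mul_eq {c d : ℕ} {B : Type*} [CStarAlgebra B] {S : cone c d →* B}
    (hS : IsNicaCovariant S) (x y : cone c d) :
    star (S x) * S y = star (S x) * ((S x * star (S x)) * (S y * star (S y))) * S y := by
  have h1 := hS.isometry x
  have h2 := hS.isometry y
  calc star (S x) * S y = (star (S x) * S x) * star (S x) * S y * (star (S y) * S y) := by
        rw [h1, h2, one_mul, mul_one]
    _ = _ := by simp only [mul_assoc]

theorem IsNicaCovariant.star_mul_eq_zero {c d : ℕ} {B : Type*} [CStarAlgebra B]
    {S : cone c d →* B} (hS : IsNicaCovariant S) {x y : cone c d}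
    (h : ¬ ∃ z, IsUpper x y z) : star (S x) * S y = 0 := by
  rw [hS.star_mul_eq, hS.disjoint x y h, mul_zero, zero_mul]

theorem IsNicaCovariant.star_mul_mul {c d : ℕ} {B : Type*} [CStarAlgebra B]
    {S : cone c d →* B} (hS : IsNicaCovariant S) (x y z : cone c d) :
    star (S (x * y)) * S (x * z) = star (S y) * S z := by
  rw [map_mul, map_mul, star_mul, mul_assoc, ← mul_assoc (star (S x)), hS.isometry, one_mul]

/-- If xp = yq is the join, its range projection sits between S_x^* and S_y and leaves S_p S_q^*.
This is why monomials are closed under multiplication up to 0. -/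
theorem IsNicaCovariant.star_mul_eq_monomial {c d : ℕ} (hc : 0 < c) (hd : 0 < d) {B : Type*}
    [CStarAlgebra B] {S : cone c d →* B} (hS : IsNicaCovariant S) (x y : cone c d) :
    star (S x) * S y = 0 ∨ ∃ p q : cone c d, star (S x) * S y = S p * star (S q) := by
  by_cases h : ∃ z, IsUpper x y z
  · right
    obtain ⟨z, hz⟩ := h
    obtain ⟨j, hj⟩ := exists_isJoin hc hd hz
    obtain ⟨p, hp⟩ : ∃ p : cone c d, j = x * p :=
      ⟨⟨_, hj.1.1⟩, Subtype.ext (by simp)⟩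
    obtain ⟨q, hq⟩ : ∃ q : cone c d, j = y * q :=
      ⟨⟨_, hj.1.2⟩, Subtype.ext (by simp)⟩
    refine ⟨p, q, ?_⟩
    have e : S j * star (S j) = (S x * S p) * star (S y * S q) := by
      rw [← map_mul, ← map_mul, ← hp, ← hq]
    rw [hS.star_mul_eq, hS.join x y j hj, e, star_mul]
    calc star (S x) * (S x * S p * (star (S q) * star (S y))) * S y
        = (star (S x) * S x) * S p * star (S q) * (star (S y) * S y) := by
          simp only [mul_assoc]
      _ = _ := by rw [hS.isometry, hS.isometry, one_mul, mul_one]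
  · exact Or.inl (hS.star_mul_eq_zero h)

/-- The linear span of the monomials `T_x T_y^*`. -/
def monomialSpan (c d : ℕ) : Submodule ℂ (CStarGP c d) :=
  Submodule.span ℂ {X | ∃ x y, X = T c d x * star (T c d y)}

theorem monomial_mem (c d : ℕ) (x y : cone c d) :
    T c d x * star (T c d y) ∈ monomialSpan c d := Submodule.subset_span ⟨x, y, rfl⟩

theorem T_mem_monomialSpan (c d : ℕ) (x : cone c d) : T c d x ∈ monomialSpan c d := by
  simpa using monomial_mem c d x 1

theorem star_mem_monomialSpan {c d : ℕ} {X : CStarGP c d} (hX : X ∈ monomialSpan c d) :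
    star X ∈ monomialSpan c d := by
  induction hX using Submodule.span_induction with
  | mem X hX =>
    obtain ⟨x, y, rfl⟩ := hX
    rw [star_mul, star_star]
    exact monomial_mem c d y x
  | zero => simp
  | add X Y _ _ hX hY => rw [star_add]; exact add_mem hX hY
  | smul k X _ hX => rw [star_smul]; exact Submodule.smul_mem _ _ hX

theorem mul_mem_monomialSpan {c d : ℕ} (hc : 0 < c) (hd : 0 < d) {X Y : CStarGP c d}
    (hX : X ∈ monomialSpan c d) (hY : Y ∈ monomialSpan c d) : X * Y ∈ monomialSpan c d := by
  induction hX, hY using Submodule.span_induction₂ with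
  | mem_mem X Y hX hY =>
    obtain ⟨x, y, rfl⟩ := hX
    obtain ⟨z, w, rfl⟩ := hY
    have e : T c d x * star (T c d y) * (T c d z * star (T c d w)) =
        T c d x * (star (T c d y) * T c d z) * star (T c d w) := by simp only [mul_assoc]
    rw [e]
    rcases (T_isNicaCovariant c d).star_mul_eq_monomial hc hd y z with h | ⟨p, q, h⟩
    · rw [h]; simp
    · rw [h, ← mul_assoc, mul_assoc, ← star_mul, ← map_mul, ← map_mul]
      exact monomial_mem c d _ _
  | zero_left Y _ => simp
  | zero_right X _ => simp
  | add_left X Y Z _ _ _ h1 h2 => rw [add_mul]; exact add_mem h1 h2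
  | add_right X Y Z _ _ _ h1 h2 => rw [mul_add]; exact add_mem h1 h2
  | smul_left k X Y _ _ h => rw [smul_mul_assoc]; exact Submodule.smul_mem _ _ h
  | smul_right k X Y _ _ h => rw [mul_smul_comm]; exact Submodule.smul_mem _ _ h

/-- The monomials `T_x T_y^*` span a `*`-subalgebra. -/
def monomialAlg {c d : ℕ} (hc : 0 < c) (hd : 0 < d) : StarSubalgebra ℂ (CStarGP c d) where
  carrier := monomialSpan c d
  mul_mem' := mul_mem_monomialSpan hc hd
  add_mem' := add_mem
  algebraMap_mem' k := by
    rw [Algebra.algebraMap_eq_smul_one]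
    exact Submodule.smul_mem _ _ (by simpa using T_mem_monomialSpan c d 1)
  star_mem' := star_mem_monomialSpan

theorem dense_monomialSpan {c d : ℕ} (hc : 0 < c) (hd : 0 < d) :
    Dense (monomialSpan c d : Set (CStarGP c d)) := by
  intro X
  have h1 : StarAlgebra.adjoin ℂ (Set.range (bigRep c d)) ≤
      (monomialAlg hc hd).map (incl c d) := by
    refine StarAlgebra.adjoin_le ?_
    rintro _ ⟨x, rfl⟩
    exact ⟨T c d x, T_mem_monomialSpan c d x, rfl⟩
  have h2 : (X.1 : Big c d) ∈ closure (Subtype.val '' (monomialSpan c d : Set (CStarGP c d))) :=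
    closure_mono h1 X.2
  exact closure_subtype.2 h2

/-- Continuous linear maps on `C*(G,P)` are determined by their values on the monomials. -/
theorem clm_ext_monomial {c d : ℕ} (hc : 0 < c) (hd : 0 < d) {f g : CStarGP c d →L[ℂ] ℂ}
    (h : ∀ x y, f (T c d x * star (T c d y)) = g (T c d x * star (T c d y))) : f = g := by
  refine ContinuousLinearMap.ext_on (dense_monomialSpan hc hd) ?_
  rintro _ ⟨x, y, rfl⟩
  exact h x y

/-! ### The KMS condition on monomials -/

/-- Positivity at x, 1 + x and 1 + ix makes the imaginary parts of the cross terms vanish. -/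
theorem IsState.map_star {A : Type*} [CStarAlgebra A] {φ : WeakDual ℂ A} (hφ : IsState φ) (x : A) :
    φ (star x) = star (φ x) := by
  have h0 : (φ (star x * x)).im = 0 := (Complex.le_def.1 (hφ.1 x)).2.symm
  have h1 := (Complex.le_def.1 (hφ.1 (1 + x))).2
  have h2 := (Complex.le_def.1 (hφ.1 (1 + Complex.I • x))).2
  simp only [star_add, star_one, star_smul, add_mul, mul_add, one_mul, mul_one, map_add, hφ.2,
    mul_smul_comm, smul_mul_assoc, map_smul, Complex.star_def, Complex.conj_I, smul_eq_mul, Complex.add_im,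
    Complex.mul_im, Complex.mul_re, Complex.neg_re, Complex.neg_im,
    Complex.I_re, Complex.I_im, Complex.one_im, Complex.zero_im] at h1 h2
  apply Complex.ext
  · rw [Complex.star_def, Complex.conj_re]; linarith
  · rw [Complex.star_def, Complex.conj_im]; linarith

/-- The relation `φ(T_x X) = e^{-βθ(x)} φ(X T_x)`. -/
def IsTwistedTrace {c d : ℕ} (β : ℝ) (φ : WeakDual ℂ (CStarGP c d)) : Prop :=
  ∀ (x : cone c d) (X : CStarGP c d),
    φ (T c d x * X) = Real.exp (-β * height (x : BS c d)) * φ (X * T c d x)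

/-- The entire extension of t ↦ α_t(T_x) is z ↦ e^{izθ(x)} T_x, which is e^{-βθ(x)} T_x at z = iβ.
-/
theorem IsKMS.isTwistedTrace {c d : ℕ} {β : ℝ} {φ : WeakDual ℂ (CStarGP c d)}
    (h : IsKMS (dynamics c d) β φ) : IsTwistedTrace β φ := by
  intro x X
  have := h.2 (T c d x) X
    (fun z => Complex.exp (Complex.I * z * (height (x : BS c d) : ℤ)) • T c d x)
    (by fun_prop) (fun t => (dynamics_T c d t x).symm)
  rw [this, mul_smul_comm, map_smul, smul_eq_mul]
  congr 1
  push_cast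
  congr 1
  linear_combination (β : ℂ) * (height (x : BS c d) : ℂ) * Complex.I_mul_I

namespace IsTwistedTrace

variable {c d : ℕ} {β : ℝ} {φ : WeakDual ℂ (CStarGP c d)}

theorem mul_star_T (hs : IsState φ) (h : IsTwistedTrace β φ) (x : cone c d) (X : CStarGP c d) :
    φ (X * star (T c d x)) =
      Real.exp (-β * height (x : BS c d)) * φ (star (T c d x) * X) := by
  have e := congrArg star (h x (star X))
  rw [← hs.map_star, star_mul, star_star] at e
  rw [e, StarMul.star_mul, ← hs.map_star, star_mul, star_star, mul_comm]
  congr 1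
  exact Complex.conj_ofReal _

theorem monomial_mul (hs : IsState φ) (h : IsTwistedTrace β φ) (x y : cone c d)
    (X : CStarGP c d) :
    φ (T c d x * star (T c d y) * X) =
      Real.exp (-β * (height (x : BS c d) - height (y : BS c d))) *
        φ (X * (T c d x * star (T c d y))) := by
  rw [← mul_assoc, mul_star_T hs h, mul_assoc, h, ← mul_assoc, ← mul_assoc]
  rw [← Complex.ofReal_mul, ← Real.exp_add]
  congr 4
  ring

theorem monomial_eq (h : IsTwistedTrace β φ) (x y : cone c d) :
    φ (T c d x * star (T c d y)) =
      Real.exp (-β * height (x : BS c d)) * φ (star (T c d y) * T c d x) := h x _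

/-- Twisted traces vanish on products of total degree different from `0`. -/
theorem monomial_mul_monomial_eq_zero (hβ : 0 < β) (hs : IsState φ) (h : IsTwistedTrace β φ)
    (x y z w : cone c d)
    (hne : height (x : BS c d) - height (y : BS c d) +
      (height (z : BS c d) - height (w : BS c d)) ≠ 0) :
    φ (T c d x * star (T c d y) * (T c d z * star (T c d w))) = 0 := by
  -- Moving each factor once past the other returns the original product multiplied by
  -- e^{-β·degree}, a factor different from 1 because β > 0.
  have e := monomial_mul hs h x y (T c d z * star (T c d w))
  rw [monomial_mul hs h z w, ← mul_assoc (Complex.ofReal _), ← Complex.ofReal_mul,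
    ← Real.exp_add, ← mul_add,
    ← sub_eq_zero, ← one_sub_mul, mul_eq_zero] at e
  refine e.resolve_left ?_
  rw [sub_eq_zero, ← Complex.ofReal_one, Complex.ofReal_inj, eq_comm, Real.exp_eq_one_iff]
  refine mul_ne_zero (neg_ne_zero.2 hβ.ne') ?_
  exact_mod_cast hne

theorem monomial_eq_zero (hβ : 0 < β) (hs : IsState φ) (h : IsTwistedTrace β φ)
    (x y : cone c d) (hne : height (x : BS c d) ≠ height (y : BS c d)) :
    φ (T c d x * star (T c d y)) = 0 := by
  have := monomial_mul_monomial_eq_zero hβ hs h x y 1 1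
    (by simpa [sub_eq_zero] using hne)
  simpa using this

end IsTwistedTrace

theorem star_T_pow_mul_T_pow (c d : ℕ) (j k : ℕ) :
    star (T c d (bP c d ^ k)) * T c d (bP c d ^ j) =
      if k ≤ j then T c d (bP c d ^ (j - k)) else star (T c d (bP c d ^ (k - j))) := by
  have hT := T_isNicaCovariant c d
  split_ifs with h
  · obtain ⟨n, rfl⟩ := Nat.exists_eq_add_of_le h
    have := hT.star_mul_mul (bP c d ^ k) 1 (bP c d ^ n)
    rw [mul_one, ← pow_add] at this
    simpa using this
  · obtain ⟨n, rfl⟩ := Nat.exists_eq_add_of_le (le_of_not_ge h)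
    have := hT.star_mul_mul (bP c d ^ j) (bP c d ^ n) 1
    rw [mul_one, ← pow_add] at this
    simpa using this

/-- A KMS state is determined by its values on the `T_{b^t}`. -/
theorem IsTwistedTrace.ext {c d : ℕ} (hc : 0 < c) (hd : 0 < d) {β : ℝ} (hβ : 0 < β)
    {φ φ' : WeakDual ℂ (CStarGP c d)} (hs : IsState φ) (hs' : IsState φ')
    (h : IsTwistedTrace β φ) (h' : IsTwistedTrace β φ')
    (hb : ∀ t : ℕ, φ (T c d (bP c d ^ t)) = φ' (T c d (bP c d ^ t))) : φ = φ' := by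
  refine WeakDual.toStrongDual.injective (clm_ext_monomial hc hd fun x y => ?_)
  change φ _ = φ' _
  by_cases hxy : height (x : BS c d) = height (y : BS c d)
  · rw [h.monomial_eq, h'.monomial_eq]
    congr 1
    obtain ⟨v, m, hv, rfl⟩ := exists_eq_stemP_mul hd x
    obtain ⟨w, n, hw, rfl⟩ := exists_eq_stemP_mul hd y
    -- Equal heights mean words of equal length: equal words cancel and leave a power of T_b or its
    -- adjoint, different words are orthogonal.
    by_cases hvw : w = v
    · subst hvw
      rw [(T_isNicaCovariant c d).star_mul_mul, star_T_pow_mul_T_pow]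
      split_ifs
      · exact hb _
      · rw [hs.map_star, hs'.map_star, hb]
    · rw [(T_isNicaCovariant c d).star_mul_eq_zero
        (not_exists_isUpper_of_stem_ne hc hd (by zify; rw [hv, hw, hxy]) hvw n m)]
      simp
  · rw [h.monomial_eq_zero hβ hs x y hxy, h'.monomial_eq_zero hβ hs' x y hxy]

/-! ### Twisted traces are KMS states -/

theorem dynamics_continuous (c d : ℕ) (t : ℝ) : Continuous (dynamics c d t) :=
  AddMonoidHomClass.continuous_of_bound (gaugeHom c d (Circle.exp t)) 1 fun x => by
    simpa only [one_mul] using NonUnitalStarAlgHom.norm_apply_le (gaugeHom c d (Circle.exp t)) x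

theorem dynamics_monomial (c d : ℕ) (t : ℝ) (x y : cone c d) :
    dynamics c d t (T c d x * star (T c d y)) =
      Complex.exp (Complex.I * t * (height (x : BS c d) - height (y : BS c d) : ℤ)) •
        (T c d x * star (T c d y)) := by
  rw [map_mul, StarHomClass.map_star, dynamics_T, dynamics_T, star_smul, smul_mul_smul_comm,
    Complex.star_def, ← Complex.exp_conj, ← Complex.exp_add]
  congr 2
  simp
  ring

/-- `dynamics c d t` as a continuous linear map. -/
def dynamicsCLM (c d : ℕ) (t : ℝ) : CStarGP c d →L[ℂ] CStarGP c d where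
  toFun := dynamics c d t
  map_add' := map_add _
  map_smul' := map_smul _
  cont := dynamics_continuous c d t

/-- A monomial pairs nontrivially only with monomials of opposite degree, and on those α_t is a
fixed scalar; density gives all X. -/
theorem IsTwistedTrace.mul_dynamics {c d : ℕ} (hc : 0 < c) (hd : 0 < d) {β : ℝ} (hβ : 0 < β)
    {φ : WeakDual ℂ (CStarGP c d)} (hs : IsState φ) (h : IsTwistedTrace β φ) (x y : cone c d)
    (t : ℝ) (X : CStarGP c d) :
    φ (T c d x * star (T c d y) * dynamics c d t X) =
      Complex.exp (-(Complex.I * t * (height (x : BS c d) - height (y : BS c d) : ℤ))) *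
        φ (T c d x * star (T c d y) * X) := by
  let L : CStarGP c d →L[ℂ] ℂ := (WeakDual.toStrongDual φ).comp
    (ContinuousLinearMap.mul ℂ (CStarGP c d) (T c d x * star (T c d y)))
  have key : L.comp (dynamicsCLM c d t) =
      Complex.exp (-(Complex.I * t * (height (x : BS c d) - height (y : BS c d) : ℤ))) • L := by
    refine clm_ext_monomial hc hd fun z w => ?_
    change φ (T c d x * star (T c d y) * dynamics c d t (T c d z * star (T c d w))) =
      _ * φ (T c d x * star (T c d y) * (T c d z * star (T c d w)))
    rw [dynamics_monomial, mul_smul_comm, map_smul, smul_eq_mul]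
    by_cases hne : height (x : BS c d) - height (y : BS c d) +
      (height (z : BS c d) - height (w : BS c d)) = 0
    · congr 2
      rw [eq_neg_of_add_eq_zero_right hne]
      push_cast
      ring
    · rw [h.monomial_mul_monomial_eq_zero hβ hs x y z w hne, mul_zero, mul_zero]
  exact DFunLike.congr_fun key X

theorem eq_of_differentiable_of_eq_ofReal {f g : ℂ → ℂ} (hf : Differentiable ℂ f)
    (hg : Differentiable ℂ g) (h : ∀ t : ℝ, f t = g t) : f = g := by
  refine AnalyticOnNhd.eq_of_frequently_eq (z₀ := 0)
    (fun z _ => hf.analyticAt z) (fun z _ => hg.analyticAt z) ?_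
  have ht : Filter.Tendsto (fun t : ℝ => (t : ℂ)) (nhdsWithin 0 {0}ᶜ) (nhdsWithin 0 {0}ᶜ) := by
    refine Filter.Tendsto.inf ?_ ?_
    · simpa using Complex.continuous_ofReal.tendsto 0
    · simp
  exact ht.frequently (Filter.Frequently.of_forall h)

/-- Test against a monomial Y of degree n. The entire function φ(Y F(z)) equals e^{-izn} φ(YX) on
the real line, hence everywhere. At z = iβ the factor e^{βn} cancels the e^{-βn} from moving Y past
X. Density of the monomials gives every Y. -/
theorem IsTwistedTrace.isKMS {c d : ℕ} (hc : 0 < c) (hd : 0 < d) {β : ℝ} (hβ : 0 < β)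
    {φ : WeakDual ℂ (CStarGP c d)} (hs : IsState φ) (h : IsTwistedTrace β φ) :
    IsKMS (dynamics c d) β φ := by
  refine ⟨hs, fun X Y F hF hFX => ?_⟩
  let L : CStarGP c d →L[ℂ] ℂ := WeakDual.toStrongDual φ
  have key : L.comp (ContinuousLinearMap.mul ℂ (CStarGP c d) X) =
      L.comp ((ContinuousLinearMap.mul ℂ (CStarGP c d)).flip (F (Complex.I * β))) := by
    refine clm_ext_monomial hc hd fun x y => ?_
    change φ (X * (T c d x * star (T c d y))) =
      φ (T c d x * star (T c d y) * F (Complex.I * β))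
    have e := eq_of_differentiable_of_eq_ofReal
      (f := fun z => L (ContinuousLinearMap.mul ℂ (CStarGP c d) (T c d x * star (T c d y)) (F z)))
      (g := fun z => Complex.exp (-(Complex.I * z *
        (height (x : BS c d) - height (y : BS c d) : ℤ))) * φ (T c d x * star (T c d y) * X))
      (by fun_prop) (by fun_prop)
      (fun t => by
        rw [hFX]
        exact h.mul_dynamics hc hd hβ hs x y t X)
    have e' := congrFun e (Complex.I * β)
    change φ (T c d x * star (T c d y) * F (Complex.I * β)) = _ at e'
    rw [e', h.monomial_mul hs, ← mul_assoc (Complex.exp _), Complex.ofReal_exp, ← Complex.exp_add]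
    rw [show -(Complex.I * (Complex.I * β) *
      (height (x : BS c d) - height (y : BS c d) : ℤ)) + ((-β * ((height (x : BS c d) : ℝ) -
        (height (y : BS c d) : ℝ)) : ℝ) : ℂ) = 0 by
        push_cast
        linear_combination (-(β : ℂ) * ((height (x : BS c d) : ℂ) - (height (y : BS c d) : ℂ))) *
          Complex.I_mul_I]
    simp
  exact DFunLike.congr_fun key Y

/-! ### The defect projection -/

/-- The element `1 - ∑ sᵢ sᵢ^*`. -/
def rangeDefect {A : Type*} [CStarAlgebra A] {ι : Type*} [Fintype ι] (s : ι → A) : A :=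
  1 - ∑ i, s i * star (s i)

theorem star_rangeDefect {A : Type*} [CStarAlgebra A] {ι : Type*} [Fintype ι] (s : ι → A) :
    star (rangeDefect s) = rangeDefect s := by
  simp [rangeDefect, star_sum]

theorem rangeDefect_mul_self {A : Type*} [CStarAlgebra A] {ι : Type*} [Fintype ι]
    [DecidableEq ι] {s : ι → A} (hs : ∀ i j, star (s i) * s j = if i = j then 1 else 0) :
    rangeDefect s * rangeDefect s = rangeDefect s := by
  have h : (∑ i, s i * star (s i)) * (∑ i, s i * star (s i)) = ∑ i, s i * star (s i) := by
    rw [Finset.sum_mul_sum]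
    refine Finset.sum_congr rfl fun i _ => ?_
    have : ∀ j, s i * star (s i) * (s j * star (s j)) =
        if i = j then s i * star (s j) else 0 := by
      intro j
      rw [mul_assoc, ← mul_assoc (star _), hs]
      split_ifs <;> simp
    simp [this]
  rw [rangeDefect, mul_sub, sub_mul, sub_mul, h]
  simp

theorem map_mul_rangeDefect {A : Type*} [CStarAlgebra A] {ι : Type*} [Fintype ι] (s : ι → A)
    (φ : WeakDual ℂ A) (X : A) :
    φ (X * rangeDefect s) = φ X - ∑ i, φ (X * (s i * star (s i))) := by
  rw [rangeDefect, mul_sub, mul_one, map_sub, Finset.mul_sum, map_sum]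

theorem map_rangeDefect_mul {A : Type*} [CStarAlgebra A] {ι : Type*} [Fintype ι] (s : ι → A)
    (φ : WeakDual ℂ A) (X : A) :
    φ (rangeDefect s * X) = φ X - ∑ i, φ (s i * star (s i) * X) := by
  rw [rangeDefect, sub_mul, one_mul, map_sub, Finset.sum_mul, map_sum]

theorem IsState.sum_nonneg {A : Type*} [CStarAlgebra A] {φ : WeakDual ℂ A} (hφ : IsState φ)
    {ι : Type*} (s : Finset ι) (w : ι → ℂ) (y : ι → A) :
    0 ≤ ∑ k ∈ s, ∑ j ∈ s, star (w k) * w j * φ (star (y k) * y j) := by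
  have := hφ.1 (∑ j ∈ s, w j • y j)
  rw [star_sum, Finset.sum_mul_sum, map_sum] at this
  simpa only [map_sum, star_smul, smul_mul_smul_comm, map_smul, smul_eq_mul] using this

/-- The projection `1 - ∑_{i<d} T_{b^i a} T_{b^i a}^*`. -/
def defect (c d : ℕ) : CStarGP c d := rangeDefect fun i : Fin d => T c d (stemP c [i])

theorem star_defect (c d : ℕ) : star (defect c d) = defect c d := star_rangeDefect _

theorem star_T_stem_mul_T_stem {c d : ℕ} (hc : 0 < c) (hd : 0 < d) (i j : Fin d) :
    star (T c d (stemP c [i])) * T c d (stemP c [j]) = if i = j then 1 else 0 := by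
  split_ifs with h
  · rw [h, (T_isNicaCovariant c d).isometry]
  · refine (T_isNicaCovariant c d).star_mul_eq_zero ?_
    simpa using not_exists_isUpper_of_stem_ne hc hd (v := [i]) (w := [j]) rfl (by simpa using h) 0 0

theorem defect_mul_self {c d : ℕ} (hc : 0 < c) (hd : 0 < d) :
    defect c d * defect c d = defect c d :=
  rangeDefect_mul_self (star_T_stem_mul_T_stem hc hd)

theorem stemP_singleton {c d : ℕ} (i : Fin d) :
    stemP c [i] = bP c d ^ (i : ℕ) * aP c d :=
  Subtype.ext (by simp [stemP, stem_cons, bP, aP])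

theorem bP_pow_mul_aP (c d q : ℕ) : bP c d ^ (d * q) * aP c d = aP c d * bP c d ^ (c * q) := by
  refine Subtype.ext ?_
  have := gA_mul_gB_zpow c d q
  simp only [← Nat.cast_mul, zpow_natCast] at this
  simpa [bP, aP] using this

/-- Powers of b commute, so b^i cancels and leaves T_a^* T_{b^t a}. Now b^t a is the stem of the
letter t mod d followed by b^{c⌊t/d⌋}, orthogonal to a unless that letter is 0. -/
theorem star_T_stem_mul_T_pow_mul {c d : ℕ} (hc : 0 < c) (hd : 0 < d) (i : Fin d) (t : ℕ) :
    star (T c d (stemP c [i])) * (T c d (bP c d ^ t) * T c d (stemP c [i])) =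
      if d ∣ t then T c d (bP c d ^ (c * (t / d))) else 0 := by
  have hT := T_isNicaCovariant c d
  have e : bP c d ^ t * aP c d = stemP c [⟨t % d, Nat.mod_lt t hd⟩] * bP c d ^ (c * (t / d)) := by
    rw [stemP_singleton, mul_assoc, ← bP_pow_mul_aP, ← mul_assoc, ← pow_add, Nat.mod_add_div]
  have ha : aP c d = stemP c [⟨0, hd⟩] := by rw [stemP_singleton]; simp
  rw [← map_mul, stemP_singleton, ← mul_assoc, ← pow_add, add_comm, pow_add, mul_assoc,
    hT.star_mul_mul, e]
  split_ifs with h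
  · have h0 : (⟨t % d, Nat.mod_lt t hd⟩ : Fin d) = ⟨0, hd⟩ :=
      Fin.ext (Nat.mod_eq_zero_of_dvd h)
    rw [h0, ← ha]
    have := hT.star_mul_mul (aP c d) 1 (bP c d ^ (c * (t / d)))
    simpa using this
  · rw [ha]
    refine hT.star_mul_eq_zero ?_
    have := not_exists_isUpper_of_stem_ne hc hd (v := [⟨0, hd⟩])
      (w := [⟨t % d, Nat.mod_lt t hd⟩]) rfl
      (by simpa [Fin.ext_iff, eq_comm, Nat.dvd_iff_mod_eq_zero] using h) 0 (c * (t / d))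
    simpa using this

theorem height_stemP (c : ℕ) {d : ℕ} (w : List (Fin d)) :
    height ((stemP c w : cone c d) : BS c d) = w.length := height_stem c w

theorem height_bP_pow (c d t : ℕ) : height ((bP c d ^ t : cone c d) : BS c d) = 0 := by
  simp [bP]

/-- The recursion satisfied by the values of a KMS state on the `T_{b^t}`. -/
theorem IsTwistedTrace.recursion {c d : ℕ} (hc : 0 < c) (hd : 0 < d) {β : ℝ}
    {φ : WeakDual ℂ (CStarGP c d)} (h : IsTwistedTrace β φ) (t : ℕ) :
    φ (T c d (bP c d ^ t)) = φ (T c d (bP c d ^ t) * defect c d) +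
      if d ∣ t then Real.exp (-β) * d * φ (T c d (bP c d ^ (c * (t / d)))) else 0 := by
  have e : ∀ i : Fin d, φ (T c d (bP c d ^ t) *
      (T c d (stemP c [i]) * star (T c d (stemP c [i])))) =
      if d ∣ t then Real.exp (-β) * φ (T c d (bP c d ^ (c * (t / d)))) else 0 := by
    intro i
    rw [← mul_assoc, ← map_mul, h.monomial_eq, map_mul (T c d), star_T_stem_mul_T_pow_mul hc hd,
      Submonoid.coe_mul, height_mul, height_bP_pow, height_stemP]
    split_ifs <;> simp
  rw [defect, map_mul_rangeDefect, Finset.sum_congr rfl fun i _ => e i]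
  split_ifs
  · simp; ring
  · simp

/-- The projection Q has degree 0, so it commutes with everything under φ, and Q² = Q. -/
theorem IsTwistedTrace.defect_mul_mul_defect {c d : ℕ} (hc : 0 < c) (hd : 0 < d) {β : ℝ}
    {φ : WeakDual ℂ (CStarGP c d)} (hs : IsState φ) (h : IsTwistedTrace β φ) (X : CStarGP c d) :
    φ (defect c d * X * defect c d) = φ (X * defect c d) := by
  have key : ∀ Y, φ (defect c d * Y) = φ (Y * defect c d) := by
    intro Y
    rw [defect, map_mul_rangeDefect, map_rangeDefect_mul]
    congr 1
    refine Finset.sum_congr rfl fun i _ => ?_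
    rw [h.monomial_mul hs]
    simp
  rw [mul_assoc, key, mul_assoc, defect_mul_self hc hd]

/-- The two-sided extension of a sequence by `g(-n) = conj g(n)`. -/
def hermitianExtend (G : ℕ → ℂ) (n : ℤ) : ℂ :=
  if 0 ≤ n then G n.toNat else star (G (-n).toNat)

/-- The double sum is φ(Y^*Y) for Y = ∑ w_j T_{b^j} Q, because T_{b^k}^* T_{b^j} depends only on j -
k. -/
theorem IsTwistedTrace.posDef {c d : ℕ} (hc : 0 < c) (hd : 0 < d) {β : ℝ}
    {φ : WeakDual ℂ (CStarGP c d)} (hs : IsState φ) (h : IsTwistedTrace β φ) (N : ℕ)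
    (w : ℕ → ℂ) :
    0 ≤ ∑ k ∈ Finset.range N, ∑ j ∈ Finset.range N, star (w k) * w j *
      hermitianExtend (fun t => φ (T c d (bP c d ^ t) * defect c d)) (j - k) := by
  have e : ∀ j k : ℕ, φ (star (T c d (bP c d ^ k) * defect c d) *
      (T c d (bP c d ^ j) * defect c d)) =
      hermitianExtend (fun t => φ (T c d (bP c d ^ t) * defect c d)) (j - k) := by
    intro j k
    have e1 : star (T c d (bP c d ^ k) * defect c d) * (T c d (bP c d ^ j) * defect c d) =
        defect c d * (star (T c d (bP c d ^ k)) * T c d (bP c d ^ j)) * defect c d := by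
      rw [star_mul, star_defect]; simp only [mul_assoc]
    rw [e1, star_T_pow_mul_T_pow, hermitianExtend]
    split_ifs with h1 h2 h2
    · rw [h.defect_mul_mul_defect hc hd hs]
      congr 4
      omega
    · omega
    · omega
    · rw [show (-((j : ℤ) - k)).toNat = k - j by omega,
        ← h.defect_mul_mul_defect hc hd hs (T c d (bP c d ^ (k - j))), ← hs.map_star, star_mul,
        star_mul, star_defect, mul_assoc]
  simpa only [e] using hs.sum_nonneg (Finset.range N) w
    (fun j => T c d (bP c d ^ j) * defect c d)

/-! ### Weighted shifts on `ℓ²` -/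

/-- The Hilbert space `ℓ²(ι)`. -/
abbrev Ell2 (ι : Type) : Type := lp (fun _ : ι => ℂ) 2

open Classical in
/-- The standard basis vectors of `ℓ²(ι)`. -/
def ket {ι : Type} (i : ι) : Ell2 ι := lp.single 2 i (1 : ℂ)

theorem inner_ket_left {ι : Type} (i : ι) (f : Ell2 ι) : inner ℂ (ket i) f = f i := by
  classical
  rw [ket, lp.inner_single_left]
  simp

theorem inner_ket_ket {ι : Type} [DecidableEq ι] (i j : ι) :
    inner ℂ (ket i) (ket j) = if i = j then (1 : ℂ) else 0 := by
  rw [inner_ket_left, ket]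
  by_cases h : i = j
  · subst h
    simp
  · rw [if_neg h]
    exact @lp.single_apply_ne ι (fun _ => ℂ) _ (Classical.decEq ι) 2 j 1 i h

theorem norm_ket {ι : Type} (i : ι) : ‖ket i‖ = 1 := by
  classical
  exact (lp.norm_single (E := fun _ : ι => ℂ) (p := 2) (by simp) i 1).trans (by simp)

theorem ext_ket {ι : Type} {A B : Ell2 ι →L[ℂ] Ell2 ι} (h : ∀ i, A (ket i) = B (ket i)) :
    A = B := by
  classical
  ext1 f
  have hf := lp.hasSum_single (p := 2) (by simp) f
  have e : ∀ i, lp.single 2 i (f i) = f i • (ket i : Ell2 ι) := by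
    intro i
    have : ket i = lp.single (E := fun _ : ι => ℂ) 2 i (1 : ℂ) := by
      unfold ket; congr!
    rw [this, ← lp.single_smul, smul_eq_mul, mul_one]
  simp only [e] at hf
  refine (hf.mapL A).unique ?_
  simpa only [map_smul, h] using hf.mapL B

theorem orthonormal_shift {ι : Type} {σ : ι → ι} (hσ : Function.Injective σ) (u : ι → Circle) :
    Orthonormal ℂ fun i => (u i : ℂ) • (ket (σ i) : Ell2 ι) := by
  classical
  rw [orthonormal_iff_ite]
  intro i j
  rw [inner_smul_left, inner_smul_right, inner_ket_ket]
  by_cases h : i = j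
  · subst h
    simp [← Complex.normSq_eq_conj_mul_self]
  · simp [h, hσ.ne h]

/-- The operator with `e_i ↦ u_i e_{σ i}`. -/
def shift {ι : Type} {σ : ι → ι} (hσ : Function.Injective σ) (u : ι → Circle) :
    Ell2 ι →L[ℂ] Ell2 ι :=
  (orthonormal_shift hσ u).orthogonalFamily.linearIsometry.toContinuousLinearMap

theorem shift_ket {ι : Type} {σ : ι → ι} (hσ : Function.Injective σ) (u : ι → Circle) (i : ι) :
    shift hσ u (ket i) = (u i : ℂ) • ket (σ i) := by
  classical
  have := (orthonormal_shift hσ u).orthogonalFamily.linearIsometry_apply_single (i := i) (1 : ℂ)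
  simp only [LinearIsometry.toSpanSingleton_apply, one_smul] at this
  rw [← this, shift, ket]
  simp only [LinearIsometry.coe_toContinuousLinearMap]

theorem star_shift_mul_shift {ι : Type} {σ : ι → ι} (hσ : Function.Injective σ)
    (u : ι → Circle) : star (shift hσ u) * shift hσ u = 1 := by
  rw [ContinuousLinearMap.star_eq_adjoint]
  exact (ContinuousLinearMap.norm_map_iff_adjoint_comp_self _).1
    fun x => LinearIsometry.norm_map _ x

theorem star_shift_ket {ι : Type} {σ : ι → ι} (hσ : Function.Injective σ) (u : ι → Circle)
    (i : ι) : star (shift hσ u) (ket (σ i)) = star (u i : ℂ) • ket i := by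
  have h1 : ket (σ i) = star (u i : ℂ) • shift hσ u (ket i) := by
    rw [shift_ket, smul_smul, Complex.star_def, ← Complex.normSq_eq_conj_mul_self]
    simp
  have h2 := DFunLike.congr_fun (star_shift_mul_shift hσ u) (ket i)
  rw [h1, map_smul]
  congr 1

theorem star_shift_ket_of_notMem {ι : Type} {σ : ι → ι} (hσ : Function.Injective σ)
    (u : ι → Circle) {j : ι} (hj : j ∉ Set.range σ) : star (shift hσ u) (ket j) = 0 := by
  classical
  ext i
  rw [← inner_ket_left, ContinuousLinearMap.star_eq_adjoint,
    ContinuousLinearMap.adjoint_inner_right, shift_ket, inner_smul_left, inner_ket_ket,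
    if_neg fun h => hj ⟨i, h⟩]
  simp

open Classical in
theorem shift_mul_star_shift_ket {ι : Type} {σ : ι → ι} (hσ : Function.Injective σ)
    (u : ι → Circle) (j : ι) :
    (shift hσ u * star (shift hσ u)) (ket j) = if j ∈ Set.range σ then ket j else 0 := by
  rw [mul_apply_eq_comp]
  split_ifs with h
  · obtain ⟨i, rfl⟩ := h
    rw [star_shift_ket, map_smul, shift_ket, smul_smul, Complex.star_def,
      ← Complex.normSq_eq_conj_mul_self]
    simp
  · rw [star_shift_ket_of_notMem hσ u h, map_zero]

/-! ### The action of the cone on stems -/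

section Action

variable {c d : ℕ}

/-- The word `v` with `x * stem w = stem v * b^m`. -/
def actWord (hd : 0 < d) (x : cone c d) (w : List (Fin d)) : List (Fin d) :=
  (exists_cone_mul_stem hd x.2 w).choose

/-- The exponent `m` with `x * stem w = stem v * b^m`. -/
def actExp (hd : 0 < d) (x : cone c d) (w : List (Fin d)) : ℤ :=
  (exists_cone_mul_stem hd x.2 w).choose_spec.choose

theorem length_actWord (hd : 0 < d) (x : cone c d) (w : List (Fin d)) :
    ((actWord hd x w).length : ℤ) = w.length + height (x : BS c d) :=
  (exists_cone_mul_stem hd x.2 w).choose_spec.choose_spec.1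

theorem mul_stem_eq (hd : 0 < d) (x : cone c d) (w : List (Fin d)) :
    (x : BS c d) * stem c w = stem c (actWord hd x w) * gB c d ^ actExp hd x w :=
  (exists_cone_mul_stem hd x.2 w).choose_spec.choose_spec.2.2

theorem act_unique (hc : 0 < c) (hd : 0 < d) {x : cone c d} {w v : List (Fin d)} {m : ℤ}
    (h : (x : BS c d) * stem c w = stem c v * gB c d ^ m) :
    actWord hd x w = v ∧ actExp hd x w = m :=
  stem_mul_zpow_inj hc hd ((mul_stem_eq hd x w).symm.trans h)

/-- If x·stem(v) and x·stem(w) have the same word, they differ by a power of b on the right; cancel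
x and use unique normal forms. -/
theorem actWord_injective (hc : 0 < c) (hd : 0 < d) (x : cone c d) :
    Function.Injective (actWord hd x) := by
  intro v w h
  have h1 := mul_stem_eq hd x v
  have h2 := mul_stem_eq hd x w
  rw [← h] at h2
  refine (stem_mul_zpow_inj hc hd (m := -actExp hd x v) (n := -actExp hd x w) ?_).1
  apply mul_left_cancel (a := (x : BS c d))
  rw [← mul_assoc, ← mul_assoc, h1, h2]
  simp

theorem act_one (hc : 0 < c) (hd : 0 < d) (w : List (Fin d)) :
    actWord hd (1 : cone c d) w = w ∧ actExp hd (1 : cone c d) w = 0 :=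
  act_unique hc hd (by simp)

/-- The exponent is a cocycle over the action on words, which makes the phases z^m multiplicative in
`stemRep`. -/
theorem act_mul (hc : 0 < c) (hd : 0 < d) (x y : cone c d) (w : List (Fin d)) :
    actWord hd (x * y) w = actWord hd x (actWord hd y w) ∧
      actExp hd (x * y) w = actExp hd x (actWord hd y w) + actExp hd y w := by
  refine act_unique hc hd ?_
  rw [Submonoid.coe_mul, mul_assoc, mul_stem_eq hd y, ← mul_assoc, mul_stem_eq hd x, mul_assoc,
    zpow_add]

theorem act_stem_singleton (hc : 0 < c) (hd : 0 < d) (i : Fin d) (w : List (Fin d)) :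
    actWord hd (stemP c [i]) w = i :: w ∧ actExp hd (stemP c [i]) w = 0 :=
  act_unique hc hd (by simp [stemP, stem_cons])

theorem act_bP_pow_nil (hc : 0 < c) (hd : 0 < d) (t : ℕ) :
    actWord hd (bP c d ^ t) [] = [] ∧ actExp hd (bP c d ^ t) [] = t :=
  act_unique hc hd (by simp [bP])

/-! ### Ranges of the action in terms of the order -/

theorem Le.mul_zpow {x g : BS c d} (h : Le x g) {k : ℤ} (hk : 0 ≤ k) :
    Le x (g * gB c d ^ k) := by
  unfold Le at *
  rw [← mul_assoc]
  exact mul_mem h (gB_zpow_mem_cone c d hk)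

theorem Le.trans {x y z : BS c d} (h : Le x y) (h' : Le y z) : Le x z := by
  unfold Le at *
  have := mul_mem h h'
  rwa [mul_assoc, mul_inv_cancel_left] at this

/-- With `exists_le_of_mem_range_actWord` this characterizes the range: j is hit by x iff x lies
below stem(j) b^n for some n. Range projections then follow the order of P. -/
theorem mem_range_actWord_of_le (hc : 0 < c) (hd : 0 < d) {x : cone c d} {j : List (Fin d)}
    {n : ℤ} (h : Le (x : BS c d) (stem c j * gB c d ^ n)) : j ∈ Set.range (actWord hd x) := by
  obtain ⟨w, k, -, -, hw⟩ := exists_eq_stem_mul hd h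
  refine ⟨w, (stem_mul_zpow_inj hc hd (m := actExp hd x w + k) (n := n) ?_).1⟩
  rw [zpow_add, ← mul_assoc, ← mul_stem_eq hd, mul_assoc, ← hw, mul_inv_cancel_left]

theorem exists_le_of_mem_range_actWord (hd : 0 < d) {x : cone c d} {j : List (Fin d)}
    (h : j ∈ Set.range (actWord hd x)) :
    ∃ n : ℤ, 0 ≤ n ∧ ∀ m : ℤ, n ≤ m → Le (x : BS c d) (stem c j * gB c d ^ m) := by
  obtain ⟨w, rfl⟩ := h
  refine ⟨max 0 (actExp hd x w), le_max_left _ _, fun m hm => ?_⟩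
  have h1 : Le (x : BS c d) (stem c (actWord hd x w) * gB c d ^ actExp hd x w) := by
    unfold Le
    rw [← mul_stem_eq hd, inv_mul_cancel_left]
    exact stem_mem_cone c w
  have := h1.mul_zpow (k := m - actExp hd x w) (by have := le_max_right 0 (actExp hd x w); omega)
  rwa [mul_assoc, ← zpow_add, add_sub_cancel] at this

theorem exists_isUpper_of_mem_range (hd : 0 < d) {x y : cone c d} {j : List (Fin d)}
    (hx : j ∈ Set.range (actWord hd x)) (hy : j ∈ Set.range (actWord hd y)) :
    ∃ (z : cone c d) (n : ℤ), (z : BS c d) = stem c j * gB c d ^ n ∧ IsUpper x y z := by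
  obtain ⟨n, hn, h1⟩ := exists_le_of_mem_range_actWord hd hx
  obtain ⟨m, hm, h2⟩ := exists_le_of_mem_range_actWord hd hy
  exact ⟨⟨stem c j * gB c d ^ max n m, mul_mem (stem_mem_cone c j)
    (gB_zpow_mem_cone c d (hn.trans (le_max_left _ _)))⟩, max n m, rfl,
    h1 _ (le_max_left _ _), h2 _ (le_max_right _ _)⟩

theorem mem_range_actWord_mono (hc : 0 < c) (hd : 0 < d) {x z : cone c d} {j : List (Fin d)}
    (h : Le (x : BS c d) z) (hj : j ∈ Set.range (actWord hd z)) :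
    j ∈ Set.range (actWord hd x) := by
  obtain ⟨n, -, h1⟩ := exists_le_of_mem_range_actWord hd hj
  exact mem_range_actWord_of_le hc hd (h.trans (h1 n le_rfl))

end Action

/-! ### The representations on `ℓ²` of the stems -/

section Rep

variable {c d : ℕ} (hc : 0 < c) (hd : 0 < d)

/-- The representation of `P` on `ℓ²` of the stems with `b` acting on the vacuum by `z`. -/
def stemRep (z : Circle) : cone c d →* (Ell2 (List (Fin d)) →L[ℂ] Ell2 (List (Fin d))) where
  toFun x := shift (actWord_injective hc hd x) fun w => z ^ actExp hd x w
  map_one' := ext_ket fun w => by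
    rw [shift_ket, (act_one hc hd w).1, (act_one hc hd w).2]
    simp
  map_mul' x y := ext_ket fun w => by
    rw [shift_ket, mul_apply_eq_comp, shift_ket, map_smul, shift_ket,
      (act_mul hc hd x y w).1, (act_mul hc hd x y w).2, smul_smul, zpow_add, mul_comm,
      Circle.coe_mul]

theorem stemRep_ket (z : Circle) (x : cone c d) (w : List (Fin d)) :
    stemRep hc hd z x (ket w) = ((z ^ actExp hd x w : Circle) : ℂ) • ket (actWord hd x w) :=
  shift_ket (actWord_injective hc hd x) _ _

open Classical in
theorem stemRep_mul_star_ket (z : Circle) (x : cone c d) (w : List (Fin d)) :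
    (stemRep hc hd z x * star (stemRep hc hd z x)) (ket w) =
      if w ∈ Set.range (actWord hd x) then ket w else 0 :=
  shift_mul_star_shift_ket (actWord_injective hc hd x) _ _

/-- All range projections are diagonal in the basis of words, so covariance says that the ranges of
x and y meet exactly in the range of the join, or not at all if there is no upper bound. -/
theorem stemRep_isNicaCovariant (z : Circle) : IsNicaCovariant (stemRep hc hd z) where
  isometry x := star_shift_mul_shift (actWord_injective hc hd x) _
  join x y j hj := by
    classical
    refine ext_ket fun w => ?_
    rw [mul_apply_eq_comp, stemRep_mul_star_ket, stemRep_mul_star_ket]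
    by_cases h : w ∈ Set.range (actWord hd j)
    · rw [if_pos (mem_range_actWord_mono hc hd hj.1.2 h), stemRep_mul_star_ket,
        if_pos (mem_range_actWord_mono hc hd hj.1.1 h), if_pos h]
    · rw [if_neg h]
      split_ifs with hy
      · rw [stemRep_mul_star_ket, if_neg]
        intro hx
        obtain ⟨u, n, hu, hup⟩ := exists_isUpper_of_mem_range hd hx hy
        exact h (mem_range_actWord_of_le hc hd (n := n) (hu ▸ hj.2 u hup))
      · rw [map_zero]
  disjoint x y hxy := by
    classical
    refine ext_ket fun w => ?_
    rw [mul_apply_eq_comp, stemRep_mul_star_ket, zero_apply]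
    split_ifs with hy
    · rw [stemRep_mul_star_ket, if_neg]
      intro hx
      obtain ⟨u, n, -, hup⟩ := exists_isUpper_of_mem_range hd hx hy
      exact hxy ⟨u, hup⟩
    · rw [map_zero]

instance nontrivial_ell2 {ι : Type} [Nonempty ι] : Nontrivial (Ell2 ι) :=
  ⟨⟨ket (Classical.arbitrary ι), 0, fun h => by
    have := norm_ket (Classical.arbitrary ι)
    rw [h, norm_zero] at this
    exact zero_ne_one this⟩⟩

/-- The representation of `C*(G,P)` on `ℓ²` of the stems. -/
def stemHom (z : Circle) :
    CStarGP c d →⋆ₐ[ℂ] (Ell2 (List (Fin d)) →L[ℂ] Ell2 (List (Fin d))) :=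
  (exists_unique_lift _ (stemRep_isNicaCovariant hc hd z)).choose

theorem stemHom_T (z : Circle) (x : cone c d) : stemHom hc hd z (T c d x) = stemRep hc hd z x :=
  (exists_unique_lift _ (stemRep_isNicaCovariant hc hd z)).choose_spec.1 x

end Rep

/-! ### Gibbs states -/

theorem exp_mul_lt_one {d : ℕ} (hd : 0 < d) {β : ℝ} (hβ : Real.log d < β) :
    Real.exp (-β) * d < 1 := by
  have h : (0 : ℝ) < d := by exact_mod_cast hd
  rw [Real.exp_neg, inv_mul_lt_one₀ (Real.exp_pos β)]
  exact (Real.log_lt_iff_lt_exp h).1 hβ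

theorem pos_of_log_lt {d : ℕ} {β : ℝ} (hβ : Real.log d < β) : 0 < β :=
  (Real.log_natCast_nonneg d).trans_lt hβ

/-- There are dⁿ words of length n, so this is the geometric series of ratio e^{-β} d, convergent
because β > ln d. It is the partition function of the Gibbs states. -/
theorem hasSum_exp_length {d : ℕ} (hd : 0 < d) {β : ℝ} (hβ : Real.log d < β) :
    HasSum (fun w : List (Fin d) => Real.exp (-β * w.length)) (1 - Real.exp (-β) * d)⁻¹ := by
  rw [← List.equivSigmaTuple.symm.hasSum_iff]
  have h1 : ∀ n : ℕ, HasSum (fun f : Fin n → Fin d =>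
      ((fun w : List (Fin d) => Real.exp (-β * w.length)) ∘ List.equivSigmaTuple.symm) ⟨n, f⟩)
      ((Real.exp (-β) * d) ^ n) := by
    intro n
    have := hasSum_fintype (fun f : Fin n → Fin d =>
      ((fun w : List (Fin d) => Real.exp (-β * w.length)) ∘ List.equivSigmaTuple.symm) ⟨n, f⟩)
    convert this using 1
    simp [List.equivSigmaTuple, mul_pow, ← Real.exp_nat_mul, mul_comm]
  have h2 : HasSum (fun n => (Real.exp (-β) * d) ^ n) (1 - Real.exp (-β) * d)⁻¹ :=
    hasSum_geometric_of_lt_one (by positivity) (exp_mul_lt_one hd hβ)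
  refine HasSum.sigma_of_hasSum h2 h1 ?_
  refine (summable_sigma_of_nonneg fun _ => (Real.exp_pos _).le).2
    ⟨fun n => (h1 n).summable, ?_⟩
  exact (summable_congr fun n => (h1 n).tsum_eq).2 h2.summable

section Gibbs

variable {d : ℕ} {β : ℝ}

/-- The diagonal sum `∑_w e^{-β|w|} ⟨e_w, X e_w⟩` has these terms. -/
def gibbsTerm (β : ℝ) (X : Ell2 (List (Fin d)) →L[ℂ] Ell2 (List (Fin d))) (w : List (Fin d)) :
    ℂ :=
  Real.exp (-β * w.length) * inner ℂ (ket w) (X (ket w))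

theorem norm_gibbsTerm_le (X : Ell2 (List (Fin d)) →L[ℂ] Ell2 (List (Fin d)))
    (w : List (Fin d)) : ‖gibbsTerm β X w‖ ≤ Real.exp (-β * w.length) * ‖X‖ := by
  rw [gibbsTerm, norm_mul, Complex.norm_real, Real.norm_of_nonneg (Real.exp_pos _).le]
  gcongr
  calc ‖inner ℂ (ket w) (X (ket w))‖ ≤ ‖ket w‖ * ‖X (ket w)‖ := norm_inner_le_norm _ _
    _ ≤ ‖ket w‖ * (‖X‖ * ‖ket w‖) := by gcongr; exact X.le_opNorm _
    _ = ‖X‖ := by rw [norm_ket]; ring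

theorem summable_gibbsTerm (hd : 0 < d) (hβ : Real.log d < β)
    (X : Ell2 (List (Fin d)) →L[ℂ] Ell2 (List (Fin d))) : Summable (gibbsTerm β X) :=
  Summable.of_norm_bounded ((hasSum_exp_length hd hβ).summable.mul_right ‖X‖)
    (norm_gibbsTerm_le X)

/-- The normalized diagonal sum `(1 - e^{-β}d) ∑_w e^{-β|w|} ⟨e_w, X e_w⟩`. -/
def gibbs (hd : 0 < d) (hβ : Real.log d < β) :
    (Ell2 (List (Fin d)) →L[ℂ] Ell2 (List (Fin d))) →L[ℂ] ℂ :=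
  LinearMap.mkContinuous
    { toFun := fun X => (1 - Real.exp (-β) * d) * ∑' w, gibbsTerm β X w
      map_add' := fun X Y => by
        rw [← mul_add, ← (summable_gibbsTerm hd hβ X).tsum_add (summable_gibbsTerm hd hβ Y)]
        simp only [gibbsTerm, add_apply, inner_add_right, mul_add]
      map_smul' := fun k X => by
        simp only [gibbsTerm, smul_apply, inner_smul_right, mul_left_comm _ k,
          tsum_mul_left, RingHom.id_apply, smul_eq_mul] } 1 fun X => by
    have h1 : 0 < 1 - Real.exp (-β) * d := sub_pos.2 (exp_mul_lt_one hd hβ)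
    have h2 : ‖∑' w, gibbsTerm β X w‖ ≤ (1 - Real.exp (-β) * d)⁻¹ * ‖X‖ :=
      tsum_of_norm_bounded ((hasSum_exp_length hd hβ).mul_right ‖X‖) (norm_gibbsTerm_le X)
    have h3 : ‖(1 - Real.exp (-β) * d : ℂ)‖ = 1 - Real.exp (-β) * d := by
      have : (1 - Real.exp (-β) * d : ℂ) = ((1 - Real.exp (-β) * d : ℝ) : ℂ) := by push_cast; rfl
      rw [this, Complex.norm_real, Real.norm_of_nonneg h1.le]
    change ‖(1 - Real.exp (-β) * d : ℂ) * ∑' w, gibbsTerm β X w‖ ≤ 1 * ‖X‖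
    rw [norm_mul, h3, one_mul]
    calc _ ≤ (1 - Real.exp (-β) * d) * ((1 - Real.exp (-β) * d)⁻¹ * ‖X‖) := by gcongr
      _ = ‖X‖ := by field_simp

theorem gibbs_apply (hd : 0 < d) (hβ : Real.log d < β)
    (X : Ell2 (List (Fin d)) →L[ℂ] Ell2 (List (Fin d))) :
    gibbs hd hβ X = (1 - Real.exp (-β) * d) * ∑' w, gibbsTerm β X w := rfl

theorem norm_gibbs_le (hd : 0 < d) (hβ : Real.log d < β)
    (X : Ell2 (List (Fin d)) →L[ℂ] Ell2 (List (Fin d))) : ‖gibbs hd hβ X‖ ≤ ‖X‖ := by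
  have := (gibbs hd hβ).le_of_opNorm_le (LinearMap.mkContinuous_norm_le _ zero_le_one _) X
  simpa using this

theorem gibbs_one (hd : 0 < d) (hβ : Real.log d < β) : gibbs hd hβ 1 = 1 := by
  have h1 : (1 - Real.exp (-β) * d) ≠ 0 := (sub_pos.2 (exp_mul_lt_one hd hβ)).ne'
  have h : ∀ w : List (Fin d), gibbsTerm β 1 w = (Real.exp (-β * w.length) : ℝ) := by
    intro w
    simp [gibbsTerm, inner_self_eq_norm_sq_to_K, norm_ket]
  rw [gibbs_apply, tsum_congr h, ← Complex.ofReal_tsum, (hasSum_exp_length hd hβ).tsum_eq]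
  exact_mod_cast mul_inv_cancel₀ h1

theorem gibbs_nonneg (hd : 0 < d) (hβ : Real.log d < β)
    (X : Ell2 (List (Fin d)) →L[ℂ] Ell2 (List (Fin d))) : 0 ≤ gibbs hd hβ (star X * X) := by
  rw [gibbs_apply]
  refine mul_nonneg ?_ (tsum_nonneg fun w => ?_)
  · have := (sub_pos.2 (exp_mul_lt_one hd hβ)).le
    exact_mod_cast this
  · rw [gibbsTerm, mul_apply_eq_comp, ContinuousLinearMap.star_eq_adjoint,
      ContinuousLinearMap.adjoint_inner_right, inner_self_eq_norm_sq_to_K]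
    refine mul_nonneg (by exact_mod_cast (Real.exp_pos _).le) ?_
    have h := Complex.zero_le_real.2 (sq_nonneg ‖X (ket w)‖)
    rw [Complex.ofReal_pow] at h
    exact h

/-- Terms outside the range of σ vanish, so the diagonal sum can be reindexed by w ↦ σ w. The weight
e^{-β|σ w|} then supplies the factor e^{-βn}, and the phases match on both sides. -/
theorem gibbs_shift_mul (hd : 0 < d) (hβ : Real.log d < β) {σ : List (Fin d) → List (Fin d)}
    (hσ : Function.Injective σ) (u : List (Fin d) → Circle) (n : ℤ)
    (hn : ∀ w, ((σ w).length : ℤ) = w.length + n)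
    (X : Ell2 (List (Fin d)) →L[ℂ] Ell2 (List (Fin d))) :
    gibbs hd hβ (shift hσ u * X) = Real.exp (-β * n) * gibbs hd hβ (X * shift hσ u) := by
  have e : ∀ w, gibbsTerm β (shift hσ u * X) w =
      Real.exp (-β * w.length) * inner ℂ (star (shift hσ u) (ket w)) (X (ket w)) := by
    intro w
    rw [gibbsTerm, mul_apply_eq_comp, ContinuousLinearMap.star_eq_adjoint,
      ContinuousLinearMap.adjoint_inner_left]
  have hsupp : Function.support (gibbsTerm β (shift hσ u * X)) ⊆ Set.range σ := by
    intro w hw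
    by_contra h
    exact hw (by rw [e, star_shift_ket_of_notMem hσ u h]; simp)
  rw [gibbs_apply, gibbs_apply, ← hσ.tsum_eq hsupp, mul_left_comm,
    ← tsum_mul_left (a := (Real.exp (-β * n) : ℂ))]
  refine congrArg _ (tsum_congr fun w => ?_)
  have hw : ((σ w).length : ℝ) = w.length + n := by exact_mod_cast hn w
  rw [e, star_shift_ket, gibbsTerm, mul_apply_eq_comp, shift_ket, map_smul, inner_smul_left,
    inner_smul_right, hw, mul_add, Real.exp_add]
  simp
  ring

end Gibbs

section GibbsState

variable {c d : ℕ} (hc : 0 < c) (hd : 0 < d) {β : ℝ} (hβ : Real.log d < β)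

theorem stemRep_eq_shift (z : Circle) (x : cone c d) :
    stemRep hc hd z x = shift (actWord_injective hc hd x) fun w => z ^ actExp hd x w := rfl

theorem norm_stemHom_le (z : Circle) (X : CStarGP c d) : ‖stemHom hc hd z X‖ ≤ ‖X‖ :=
  NonUnitalStarAlgHom.norm_apply_le (stemHom hc hd z) X

/-- The Gibbs state of the representation attached to `z`. -/
def pointState (z : Circle) : CStarGP c d →L[ℂ] ℂ :=
  LinearMap.mkContinuous
    { toFun := fun X => gibbs hd hβ (stemHom hc hd z X)
      map_add' := fun X Y => by simp only [map_add]
      map_smul' := fun k X => by simp only [map_smul, RingHom.id_apply] } 1 fun X => by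
    rw [one_mul]
    exact (norm_gibbs_le hd hβ _).trans (norm_stemHom_le hc hd z X)

theorem pointState_apply (z : Circle) (X : CStarGP c d) :
    pointState hc hd hβ z X = gibbs hd hβ (stemHom hc hd z X) := rfl

theorem norm_pointState_le (z : Circle) (X : CStarGP c d) : ‖pointState hc hd hβ z X‖ ≤ ‖X‖ :=
  (norm_gibbs_le hd hβ _).trans (norm_stemHom_le hc hd z X)

theorem pointState_one (z : Circle) : pointState hc hd hβ z 1 = 1 := by
  rw [pointState_apply, map_one, gibbs_one]

theorem pointState_nonneg (z : Circle) (X : CStarGP c d) :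
    0 ≤ pointState hc hd hβ z (star X * X) := by
  rw [pointState_apply, map_mul, StarHomClass.map_star]
  exact gibbs_nonneg hd hβ _

theorem pointState_T_mul (z : Circle) (x : cone c d) (X : CStarGP c d) :
    pointState hc hd hβ z (T c d x * X) =
      Real.exp (-β * height (x : BS c d)) * pointState hc hd hβ z (X * T c d x) := by
  rw [pointState_apply, pointState_apply, map_mul (stemHom hc hd z), map_mul (stemHom hc hd z),
    stemHom_T, stemRep_eq_shift]
  exact gibbs_shift_mul hd hβ (actWord_injective hc hd x) _ _ (length_actWord hd x) _

theorem continuous_tsum_zpow {ι : Type*} {u : ι → ℝ} (hu : Summable u) (hu0 : ∀ i, 0 ≤ u i)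
    (m n : ι → ℤ) (k : ι → ℂ) (hk : ∀ i, ‖k i‖ ≤ 1) :
    Continuous fun z : Circle => ∑' i, (u i : ℂ) * (star ((z ^ m i : Circle) : ℂ) *
      (((z ^ n i : Circle) : ℂ) * k i)) := by
  refine continuous_tsum (fun i => ?_) hu fun i z => ?_
  · have h : ∀ l : ℤ, Continuous fun z : Circle => ((z ^ l : Circle) : ℂ) := fun l =>
      continuous_induced_dom.comp (continuous_zpow l)
    exact continuous_const.mul ((h _).star.mul ((h _).mul continuous_const))
  · rw [norm_mul, norm_mul, norm_mul, norm_star, Circle.norm_coe, Circle.norm_coe, one_mul,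
      one_mul, Complex.norm_real, Real.norm_of_nonneg (hu0 i)]
    exact mul_le_of_le_one_right (hu0 i) (hk i)

/-- After the twisted trace relation, the value is a series of integer powers of z with coefficients
dominated by e^{-β|w|} uniformly in z. -/
theorem continuous_pointState_monomial (x y : cone c d) :
    Continuous fun z => pointState hc hd hβ z (T c d x * star (T c d y)) := by
  simp only [pointState_T_mul]
  refine continuous_const.mul ?_
  simp only [pointState_apply, map_mul, StarHomClass.map_star, stemHom_T, gibbs_apply]
  refine continuous_const.mul ?_
  have e : ∀ (z : Circle) (w : List (Fin d)),
      gibbsTerm β (star (stemRep hc hd z y) * stemRep hc hd z x) w =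
      Real.exp (-β * w.length) * (star ((z ^ actExp hd y w : Circle) : ℂ) *
        (((z ^ actExp hd x w : Circle) : ℂ) *
          inner ℂ (ket (actWord hd y w)) (ket (actWord hd x w)))) := by
    intro z w
    rw [gibbsTerm, mul_apply_eq_comp, ContinuousLinearMap.star_eq_adjoint,
      ContinuousLinearMap.adjoint_inner_right, stemRep_ket, stemRep_ket, inner_smul_left,
      inner_smul_right, Complex.star_def]
  simp only [e]
  refine continuous_tsum_zpow (hasSum_exp_length hd hβ).summable (fun w => (Real.exp_pos _).le)
    (fun w => actExp hd y w) (fun w => actExp hd x w)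
    (fun w => inner ℂ (ket (actWord hd y w)) (ket (actWord hd x w))) fun w => ?_
  refine (norm_inner_le_norm _ _).trans ?_
  rw [norm_ket, norm_ket, one_mul]

/-- The functionals are contractive uniformly in z, so continuity passes from the dense span of
monomials to norm limits. -/
theorem continuous_pointState (X : CStarGP c d) :
    Continuous fun z => pointState hc hd hβ z X := by
  have hspan : ∀ Y ∈ monomialSpan c d, Continuous fun z => pointState hc hd hβ z Y := by
    intro Y hY
    induction hY using Submodule.span_induction with
    | mem Y hY =>
      obtain ⟨x, y, rfl⟩ := hY
      exact continuous_pointState_monomial hc hd hβ x y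
    | zero => simpa using continuous_const
    | add Y Z _ _ hY hZ => simp only [map_add]; exact hY.add hZ
    | smul k Y _ hY => simp only [map_smul]; exact hY.const_smul k
  refine continuous_of_uniform_approx_of_continuous fun u hu => ?_
  obtain ⟨ε, hε, hu⟩ := Metric.mem_uniformity_dist.1 hu
  obtain ⟨Y, hY, hXY⟩ := Metric.mem_closure_iff.1 (dense_monomialSpan hc hd X) ε hε
  refine ⟨fun z => pointState hc hd hβ z Y, hspan Y hY, fun z => hu ?_⟩
  rw [dist_eq_norm, ← map_sub]
  exact (norm_pointState_le hc hd hβ z _).trans_lt (by rwa [← dist_eq_norm])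

end GibbsState

/-! ### The defect projection in the stem representations -/

theorem map_rangeDefect {A B : Type*} [CStarAlgebra A] [CStarAlgebra B] {ι : Type*} [Fintype ι]
    (f : A →⋆ₐ[ℂ] B) (s : ι → A) : f (rangeDefect s) = rangeDefect fun i => f (s i) := by
  simp [rangeDefect, map_sub, map_sum, map_mul, StarHomClass.map_star]

/-- A nonempty word lies in the range of b^i a for exactly one i, its first letter, and the empty
word in none: the defect is the projection onto the vacuum. -/
theorem rangeDefect_stemRep_ket {c d : ℕ} (hc : 0 < c) (hd : 0 < d) (z : Circle)
    (w : List (Fin d)) :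
    rangeDefect (fun i : Fin d => stemRep hc hd z (stemP c [i])) (ket w) =
      if w = [] then ket w else 0 := by
  classical
  have h : ∀ i : Fin d, Set.range (actWord hd (stemP c [i])) = Set.range (List.cons i) :=
    fun i => congrArg Set.range (funext fun v => (act_stem_singleton hc hd i v).1)
  simp only [rangeDefect, sub_apply, sum_apply, stemRep_mul_star_ket, h]
  cases w with
  | nil => simp
  | cons j w => simp

theorem pointState_pow_mul_defect {c d : ℕ} (hc : 0 < c) (hd : 0 < d) {β : ℝ}
    (hβ : Real.log d < β) (z : Circle) (t : ℕ) :
    pointState hc hd hβ z (T c d (bP c d ^ t) * defect c d) =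
      (1 - Real.exp (-β) * d) * (z : ℂ) ^ t := by
  rw [pointState_apply, map_mul, defect, map_rangeDefect, gibbs_apply]
  congr 1
  rw [tsum_eq_single []]
  · simp only [gibbsTerm, mul_apply_eq_comp, stemHom_T, rangeDefect_stemRep_ket, if_true,
      stemRep_ket, (act_bP_pow_nil hc hd t).1, (act_bP_pow_nil hc hd t).2, inner_smul_right,
      inner_self_eq_norm_sq_to_K, norm_ket]
    simp
  · intro w hw
    simp only [gibbsTerm, mul_apply_eq_comp, stemHom_T, rangeDefect_stemRep_ket, if_neg hw,
      map_zero, inner_zero_right, mul_zero]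

/-! ### Averaging point states over a measure -/

theorem integrable_of_continuous_circle {f : Circle → ℂ} (hf : Continuous f)
    (μ : Measure Circle) [IsFiniteMeasure μ] : Integrable f μ :=
  hf.integrable_of_hasCompactSupport (HasCompactSupport.of_compactSpace f)

section MeasState

variable {c d : ℕ} (hc : 0 < c) (hd : 0 < d) {β : ℝ} (hβ : Real.log d < β)

theorem integrable_pointState (μ : ProbabilityMeasure Circle) (X : CStarGP c d) :
    Integrable (fun z => pointState hc hd hβ z X) (μ : Measure Circle) :=
  integrable_of_continuous_circle (continuous_pointState hc hd hβ X) _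

/-- The functional `X ↦ ∫ φ_z(X) dμ(z)`. -/
def measFunctional (μ : ProbabilityMeasure Circle) : CStarGP c d →L[ℂ] ℂ :=
  LinearMap.mkContinuous
    { toFun := fun X => ∫ z, pointState hc hd hβ z X ∂(μ : Measure Circle)
      map_add' := fun X Y => by
        simp only [map_add]
        exact integral_add (integrable_pointState hc hd hβ μ X)
          (integrable_pointState hc hd hβ μ Y)
      map_smul' := fun k X => by
        simp only [map_smul, RingHom.id_apply]
        exact integral_smul k _ } 1 fun X => by
    have := norm_integral_le_of_norm_le_const (μ := (μ : Measure Circle))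
      (Filter.Eventually.of_forall fun z => norm_pointState_le hc hd hβ z X)
    rw [one_mul]
    refine this.trans_eq ?_
    simp

/-- The state `X ↦ ∫ φ_z(X) dμ(z)`. -/
def measState (μ : ProbabilityMeasure Circle) : WeakDual ℂ (CStarGP c d) :=
  StrongDual.toWeakDual (measFunctional hc hd hβ μ)

theorem measState_apply (μ : ProbabilityMeasure Circle) (X : CStarGP c d) :
    measState hc hd hβ μ X = ∫ z, pointState hc hd hβ z X ∂(μ : Measure Circle) := rfl

theorem isState_measState (μ : ProbabilityMeasure Circle) : IsState (measState hc hd hβ μ) := by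
  refine ⟨fun X => ?_, ?_⟩
  · rw [measState_apply]
    have h : ∀ z, pointState hc hd hβ z (star X * X) =
        ((pointState hc hd hβ z (star X * X)).re : ℂ) := fun z =>
      Complex.eq_re_of_ofReal_le (r := 0) (by simpa using pointState_nonneg hc hd hβ z X)
    rw [integral_congr_ae (Filter.Eventually.of_forall h), integral_complex_ofReal]
    exact Complex.zero_le_real.2
      (integral_nonneg fun z => (Complex.le_def.1 (pointState_nonneg hc hd hβ z X)).1)
  · simp [measState_apply, pointState_one]

theorem isTwistedTrace_measState (μ : ProbabilityMeasure Circle) :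
    IsTwistedTrace β (measState hc hd hβ μ) := by
  intro x X
  simp only [measState_apply, pointState_T_mul]
  exact integral_const_mul _ _

theorem measState_pow_mul_defect (μ : ProbabilityMeasure Circle) (t : ℕ) :
    measState hc hd hβ μ (T c d (bP c d ^ t) * defect c d) =
      (1 - Real.exp (-β) * d) * moment μ t := by
  simp only [measState_apply, pointState_pow_mul_defect]
  exact integral_const_mul _ _

end MeasState

/-! ### The recursion and its solution as a series -/

/-- A recursion `F t = K t + r [d ∣ t] F (c t / d)` with `‖r‖ < 1` has at most one bounded
solution. -/
theorem eq_of_recursion {c d : ℕ} {r : ℂ} (hr : ‖r‖ < 1) {K F F' : ℕ → ℂ} {C : ℝ}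
    (hF : ∀ t, F t = K t + if d ∣ t then r * F (c * (t / d)) else 0)
    (hF' : ∀ t, F' t = K t + if d ∣ t then r * F' (c * (t / d)) else 0)
    (hC : ∀ t, ‖F t‖ ≤ C) (hC' : ∀ t, ‖F' t‖ ≤ C) : F = F' := by
  -- Each unrolling of the recursion gains a factor ‖r‖ on the difference.
  have key : ∀ n t, ‖F t - F' t‖ ≤ ‖r‖ ^ n * (2 * C) := by
    intro n
    induction n with
    | zero =>
      intro t
      have := norm_sub_le (F t) (F' t)
      have := hC t
      have := hC' t
      simp only [pow_zero, one_mul]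
      linarith
    | succ n ih =>
      intro t
      rw [hF, hF', add_sub_add_left_eq_sub]
      split_ifs
      · rw [← mul_sub, norm_mul, pow_succ', mul_assoc]
        exact mul_le_mul_of_nonneg_left (ih _) (norm_nonneg r)
      · rw [sub_zero, norm_zero]
        have : 0 ≤ C := (norm_nonneg _).trans (hC 0)
        positivity
  funext t
  rw [← sub_eq_zero, ← norm_le_zero_iff]
  have h := (tendsto_pow_atTop_nhds_zero_of_lt_one (norm_nonneg r) hr).mul_const (2 * C)
  rw [zero_mul] at h
  exact ge_of_tendsto' h fun n => key n t

section Series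

variable {c d : ℕ} {β : ℝ} (μ : ProbabilityMeasure Circle)

theorem norm_moment_le (n : ℕ) : ‖moment μ n‖ ≤ 1 := by
  have := norm_integral_le_of_norm_le_const (μ := (μ : Measure Circle)) (C := 1)
    (f := fun z : Circle => (z : ℂ) ^ n) (Filter.Eventually.of_forall fun z => by
      rw [norm_pow, Circle.norm_coe, one_pow])
  simpa [moment] using this

/-- The index set together with `0`. -/
def indexSetZero (c d t : ℕ) : Set ℕ :=
  {k | ∀ j < k, ∃ m : ℤ, (c : ℚ) ^ j * ((d : ℚ) ^ j)⁻¹ * t = d * m}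

theorem indexSet_eq (c d t : ℕ) : indexSet c d t = indexSetZero c d t \ {0} := by
  ext k
  simp only [indexSet, indexSetZero, Set.mem_ofPred_eq, Set.mem_sdiff, Set.mem_singleton_iff,
    Nat.one_le_iff_ne_zero]
  exact and_comm

theorem zero_mem_indexSetZero (c d t : ℕ) : 0 ∈ indexSetZero c d t :=
  fun _ hj => absurd hj (Nat.not_lt_zero _)

/-- Divisibility at j = 0 is d ∣ t, and the conditions at j + 1 for t are those at j for ct/d. The
index set thus follows the recursion of the KMS values. -/
theorem succ_mem_indexSetZero_iff (hd : 0 < d) (t k : ℕ) :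
    k + 1 ∈ indexSetZero c d t ↔ d ∣ t ∧ k ∈ indexSetZero c d (c * (t / d)) := by
  have hd' : (d : ℚ) ≠ 0 := by exact_mod_cast hd.ne'
  have e : ∀ s j : ℕ, (c : ℚ) ^ (j + 1) * ((d : ℚ) ^ (j + 1))⁻¹ * ((d * s : ℕ) : ℚ) =
      (c : ℚ) ^ j * ((d : ℚ) ^ j)⁻¹ * ((c * s : ℕ) : ℚ) := by
    intro s j
    push_cast
    field_simp
    ring
  constructor
  · intro h
    obtain ⟨m, hm⟩ := h 0 (Nat.succ_pos k)
    have hdt : d ∣ t := by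
      rw [← Int.natCast_dvd_natCast]
      refine ⟨m, ?_⟩
      simp only [pow_zero, inv_one, mul_one, one_mul] at hm
      exact_mod_cast hm
    obtain ⟨s, rfl⟩ := hdt
    refine ⟨dvd_mul_right d s, fun j hj => ?_⟩
    obtain ⟨m, hm⟩ := h (j + 1) (Nat.succ_lt_succ hj)
    rw [e] at hm
    rw [Nat.mul_div_cancel_left s hd]
    exact ⟨m, hm⟩
  · rintro ⟨⟨s, rfl⟩, h⟩ j hj
    rw [Nat.mul_div_cancel_left s hd] at h
    cases j with
    | zero => exact ⟨s, by push_cast; simp⟩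
    | succ j =>
      rw [e]
      exact h j (Nat.lt_of_succ_lt_succ hj)

theorem momentTerm_succ (hd : 0 < d) (s k : ℕ) :
    momentTerm c d β μ (d * s) (k + 1) =
      Real.exp (-β) * d * momentTerm c d β μ (c * s) k := by
  have e : c ^ (k + 1) * (d * s) / d ^ (k + 1) = c ^ k * (c * s) / d ^ k := by
    rw [pow_succ d, ← Nat.mul_div_mul_right (c ^ k * (c * s)) (d ^ k) hd]
    congr 1
    ring
  have e' : Real.exp (-β * (k + 1 : ℕ)) = Real.exp (-β) * Real.exp (-β * k) := by
    rw [← Real.exp_add]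
    congr 1
    push_cast
    ring
  rw [momentTerm, momentTerm, e, e', pow_succ]
  push_cast
  ring

/-- The terms of the series, extended by zero. -/
def seriesTerm (c d : ℕ) (β : ℝ) (μ : ProbabilityMeasure Circle) (t : ℕ) : ℕ → ℂ :=
  (indexSetZero c d t).indicator (momentTerm c d β μ t)

theorem seriesTerm_zero (t : ℕ) : seriesTerm c d β μ t 0 = moment μ t := by
  rw [seriesTerm, Set.indicator_of_mem (zero_mem_indexSetZero c d t)]
  simp [momentTerm]

theorem seriesTerm_succ (hd : 0 < d) (t k : ℕ) :
    seriesTerm c d β μ t (k + 1) =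
      if d ∣ t then Real.exp (-β) * d * seriesTerm c d β μ (c * (t / d)) k else 0 := by
  split_ifs with h
  · obtain ⟨s, rfl⟩ := h
    have hs : d * s / d = s := Nat.mul_div_cancel_left s hd
    rw [hs, seriesTerm, seriesTerm]
    by_cases hk : k ∈ indexSetZero c d (c * s)
    · rw [Set.indicator_of_mem hk, Set.indicator_of_mem, momentTerm_succ μ hd]
      rw [succ_mem_indexSetZero_iff hd, hs]
      exact ⟨dvd_mul_right _ _, hk⟩
    · rw [Set.indicator_of_notMem hk, Set.indicator_of_notMem, mul_zero]
      rw [succ_mem_indexSetZero_iff hd, hs]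
      exact fun h => hk h.2
  · refine Set.indicator_of_notMem (fun hk => h ?_) _
    exact ((succ_mem_indexSetZero_iff hd t k).1 hk).1

theorem norm_momentTerm_le (t k : ℕ) :
    ‖momentTerm c d β μ t k‖ ≤ (Real.exp (-β) * d) ^ k := by
  rw [momentTerm, norm_mul, norm_mul, Complex.norm_real, Real.norm_of_nonneg (Real.exp_pos _).le,
    norm_pow, Complex.norm_natCast, mul_pow, ← Real.exp_nat_mul, mul_comm (k : ℝ)]
  exact mul_le_of_le_one_right (by positivity) (norm_moment_le μ _)

theorem norm_seriesTerm_le (t k : ℕ) :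
    ‖seriesTerm c d β μ t k‖ ≤ (Real.exp (-β) * d) ^ k :=
  (norm_indicator_le_norm_self _ _).trans (norm_momentTerm_le μ t k)

theorem hasSum_geometric_bound (hd : 0 < d) (hβ : Real.log d < β) :
    HasSum (fun k : ℕ => (Real.exp (-β) * d) ^ k) (1 - Real.exp (-β) * d)⁻¹ :=
  hasSum_geometric_of_lt_one (by positivity) (exp_mul_lt_one hd hβ)

theorem summable_momentTerm (hd : 0 < d) (hβ : Real.log d < β) (t : ℕ) :
    Summable (momentTerm c d β μ t) :=
  Summable.of_norm_bounded (hasSum_geometric_bound hd hβ).summable (norm_momentTerm_le μ t)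

theorem summable_seriesTerm (hd : 0 < d) (hβ : Real.log d < β) (t : ℕ) :
    Summable (seriesTerm c d β μ t) :=
  (summable_momentTerm μ hd hβ t).indicator _

theorem moment_add_tsum_eq (hd : 0 < d) (hβ : Real.log d < β) (t : ℕ) :
    moment μ t + ∑' k : indexSet c d t, momentTerm c d β μ t k =
      ∑' k, seriesTerm c d β μ t k := by
  rw [tsum_subtype (indexSet c d t) (momentTerm c d β μ t),
    (summable_seriesTerm μ hd hβ t).tsum_eq_zero_add, seriesTerm_zero,
    ((summable_momentTerm μ hd hβ t).indicator (indexSet c d t)).tsum_eq_zero_add,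
    Set.indicator_of_notMem (by simp [indexSet]), zero_add]
  congr 1
  refine tsum_congr fun k => ?_
  rw [seriesTerm, indexSet_eq]
  by_cases hk : k + 1 ∈ indexSetZero c d t
  · rw [Set.indicator_of_mem hk, Set.indicator_of_mem (show k + 1 ∈ indexSetZero c d t \ {0} from
      ⟨hk, by simp⟩)]
  · rw [Set.indicator_of_notMem hk, Set.indicator_of_notMem fun h => hk h.1]

/-- Splitting off k = 0 shows that the series solves the recursion of `IsTwistedTrace.recursion`,
with the moments as inhomogeneous term up to normalization. -/
theorem tsum_seriesTerm_recursion (hd : 0 < d) (hβ : Real.log d < β) (t : ℕ) :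
    ∑' k, seriesTerm c d β μ t k = moment μ t +
      if d ∣ t then Real.exp (-β) * d * ∑' k, seriesTerm c d β μ (c * (t / d)) k else 0 := by
  rw [(summable_seriesTerm μ hd hβ t).tsum_eq_zero_add, seriesTerm_zero]
  simp only [seriesTerm_succ μ hd]
  split_ifs
  · rw [tsum_mul_left]
  · rw [tsum_zero]

theorem norm_tsum_seriesTerm_le (hd : 0 < d) (hβ : Real.log d < β) (t : ℕ) :
    ‖∑' k, seriesTerm c d β μ t k‖ ≤ (1 - Real.exp (-β) * d)⁻¹ :=
  tsum_of_norm_bounded (hasSum_geometric_bound hd hβ) (norm_seriesTerm_le μ t)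

end Series

/-! ### Values on powers of `b` from the moments -/

theorem norm_exp_mul_lt_one {d : ℕ} (hd : 0 < d) {β : ℝ} (hβ : Real.log d < β) :
    ‖(Real.exp (-β) * d : ℂ)‖ < 1 := by
  rw [norm_mul, Complex.norm_real, Complex.norm_natCast,
    Real.norm_of_nonneg (Real.exp_pos _).le]
  exact exp_mul_lt_one hd hβ

theorem exists_norm_apply_le {A : Type*} [CStarAlgebra A] (φ : WeakDual ℂ A) :
    ∃ C : ℝ, 0 ≤ C ∧ ∀ x, ‖φ x‖ ≤ C * ‖x‖ :=
  ⟨‖WeakDual.toStrongDual φ‖, norm_nonneg _, fun x => (WeakDual.toStrongDual φ).le_opNorm x⟩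

theorem norm_T_le (c d : ℕ) (x : cone c d) : ‖T c d x‖ ≤ 1 := by
  have h := CStarRing.norm_star_mul_self (x := T c d x)
  rw [(T_isNicaCovariant c d).isometry] at h
  have h1 : ‖(1 : CStarGP c d)‖ ≤ 1 := by
    rcases subsingleton_or_nontrivial (CStarGP c d) with _ | _
    · rw [Subsingleton.elim (1 : CStarGP c d) 0, norm_zero]; exact zero_le_one
    · exact norm_one.le
  nlinarith [norm_nonneg (T c d x)]

/-- A twisted trace whose values on `T_{b^t} Q` are proportional to the moments of `μ` is given by
the series on the `T_{b^t}`. -/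
theorem IsTwistedTrace.apply_pow_eq {c d : ℕ} (hc : 0 < c) (hd : 0 < d) {β : ℝ}
    (hβ : Real.log d < β) {φ : WeakDual ℂ (CStarGP c d)} (h : IsTwistedTrace β φ)
    (μ : ProbabilityMeasure Circle)
    (hμ : ∀ t, φ (T c d (bP c d ^ t) * defect c d) = (1 - Real.exp (-β) * d) * moment μ t)
    (t : ℕ) :
    φ (T c d (bP c d ^ t)) = (1 - Real.exp (-β) * d) *
      (moment μ t + ∑' k : indexSet c d t, momentTerm c d β μ t k) := by
  rw [moment_add_tsum_eq μ hd hβ]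
  obtain ⟨C, hC0, hC⟩ := exists_norm_apply_le φ
  have hB1 : ∀ t, ‖φ (T c d (bP c d ^ t))‖ ≤ C := fun t =>
    (hC _).trans (mul_le_of_le_one_right hC0 (norm_T_le c d _))
  have hB2 : ∀ t, ‖(1 - Real.exp (-β) * d : ℂ) * ∑' k, seriesTerm c d β μ t k‖ ≤
      ‖(1 - Real.exp (-β) * d : ℂ)‖ * (1 - Real.exp (-β) * d)⁻¹ := fun t => by
    rw [norm_mul]
    gcongr
    exact norm_tsum_seriesTerm_le μ hd hβ t
  refine congrFun (eq_of_recursion (norm_exp_mul_lt_one hd hβ)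
    (K := fun t => (1 - Real.exp (-β) * d) * moment μ t) (c := c) (d := d)
    (F := fun t => φ (T c d (bP c d ^ t)))
    (F' := fun t => (1 - Real.exp (-β) * d) * ∑' k, seriesTerm c d β μ t k)
    (fun t => ?_) (fun t => ?_) (fun t => (hB1 t).trans (le_max_left _ _))
    (fun t => (hB2 t).trans (le_max_right _ _))) t
  · rw [h.recursion hc hd, hμ]
  · rw [tsum_seriesTerm_recursion μ hd hβ, mul_add]
    congr 1
    split_ifs
    · ring
    · ring

/-! ### Measures on the circle and their moments -/

theorem continuous_integral_probabilityMeasure {f : Circle → ℂ} (hf : Continuous f) :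
    Continuous fun μ : ProbabilityMeasure Circle => ∫ z, f z ∂(μ : Measure Circle) := by
  rw [continuous_iff_continuousAt]
  intro μ
  exact (ProbabilityMeasure.tendsto_iff_forall_integral_rclike_tendsto ℂ).1
    Filter.tendsto_id (BoundedContinuousFunction.mkOfCompact ⟨f, hf⟩)

theorem continuous_moment (t : ℕ) :
    Continuous fun μ : ProbabilityMeasure Circle => moment μ t :=
  continuous_integral_probabilityMeasure (continuous_induced_dom.pow t)

/-- The character `z ↦ z^n` as a bounded continuous function. -/
def circleMonomial (n : ℤ) : BoundedContinuousFunction Circle ℂ :=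
  BoundedContinuousFunction.mkOfCompact
    ⟨fun z => ((z ^ n : Circle) : ℂ), continuous_induced_dom.comp (continuous_zpow n)⟩

theorem circleMonomial_apply (n : ℤ) (z : Circle) :
    circleMonomial n z = ((z ^ n : Circle) : ℂ) := rfl

/-- The `*`-algebra of trigonometric polynomials. -/
def trigPolynomials : StarSubalgebra ℂ (BoundedContinuousFunction Circle ℂ) where
  carrier := Submodule.span ℂ (Set.range circleMonomial)
  mul_mem' {f g} hf hg := by
    induction hf, hg using Submodule.span_induction₂ with
    | mem_mem f g hf hg =>
      obtain ⟨m, rfl⟩ := hf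
      obtain ⟨n, rfl⟩ := hg
      refine Submodule.subset_span ⟨m + n, ?_⟩
      ext z
      simp [circleMonomial_apply, zpow_add]
    | zero_left f _ => simp
    | zero_right f _ => simp
    | add_left f g h _ _ _ h1 h2 => rw [add_mul]; exact add_mem h1 h2
    | add_right f g h _ _ _ h1 h2 => rw [mul_add]; exact add_mem h1 h2
    | smul_left k f g _ _ h => rw [smul_mul_assoc]; exact Submodule.smul_mem _ _ h
    | smul_right k f g _ _ h => rw [mul_smul_comm]; exact Submodule.smul_mem _ _ h
  add_mem' := add_mem
  algebraMap_mem' k := by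
    rw [Algebra.algebraMap_eq_smul_one]
    refine Submodule.smul_mem _ _ (Submodule.subset_span ⟨0, ?_⟩)
    ext z
    simp [circleMonomial_apply]
  star_mem' {f} hf := by
    induction hf using Submodule.span_induction with
    | mem f hf =>
      obtain ⟨n, rfl⟩ := hf
      refine Submodule.subset_span ⟨-n, ?_⟩
      ext z
      rw [circleMonomial_apply, zpow_neg, Circle.coe_inv_eq_conj]
      rfl
    | zero => simp
    | add f g _ _ hf hg => rw [star_add]; exact add_mem hf hg
    | smul k f _ hf => rw [star_smul]; exact Submodule.smul_mem _ _ hf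

/-- Negative moments are conjugates of positive ones, so the measures agree on trigonometric
polynomials, a point-separating *-algebra. -/
theorem ext_of_moment {μ ν : ProbabilityMeasure Circle} (h : ∀ t, moment μ t = moment ν t) :
    μ = ν := by
  have hint : ∀ (ρ : ProbabilityMeasure Circle) (f : BoundedContinuousFunction Circle ℂ),
      Integrable f (ρ : Measure Circle) := fun ρ f =>
    integrable_of_continuous_circle f.continuous _
  have hmono : ∀ n : ℤ, ∫ z, circleMonomial n z ∂(μ : Measure Circle) =
      ∫ z, circleMonomial n z ∂(ν : Measure Circle) := by
    intro n
    obtain ⟨t, rfl | rfl⟩ := n.eq_nat_or_neg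
    · simpa [circleMonomial_apply, moment] using h t
    · have e : ∀ z : Circle, circleMonomial (-t) z = (starRingEnd ℂ) ((z : ℂ) ^ t) := by
        intro z
        rw [circleMonomial_apply, zpow_neg, Circle.coe_inv_eq_conj]
        simp
      simp only [e, integral_conj]
      exact congrArg _ (h t)
  suffices hμν : (μ : Measure Circle) = (ν : Measure Circle) from Subtype.ext hμν
  refine ext_of_forall_mem_subalgebra_integral_eq_of_pseudoEMetric_complete_countable
    (𝕜 := ℂ) (A := trigPolynomials) ?_ ?_
  · intro z w hzw
    refine ⟨fun z => ((z ^ (1 : ℤ) : Circle) : ℂ), ⟨_, ⟨circleMonomial 1,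
      Submodule.subset_span ⟨1, rfl⟩, rfl⟩, rfl⟩, ?_⟩
    simpa [Circle.ext_iff] using hzw
  · intro f hf
    induction hf using Submodule.span_induction with
    | mem f hf =>
      obtain ⟨n, rfl⟩ := hf
      exact hmono n
    | zero => simp
    | add f g _ _ hf hg =>
      simp only [BoundedContinuousFunction.coe_add, Pi.add_apply]
      rw [integral_add (hint _ _) (hint _ _), integral_add (hint _ _) (hint _ _), hf, hg]
    | smul k f _ hf =>
      simp only [BoundedContinuousFunction.coe_smul]
      rw [integral_smul, integral_smul, hf]

/-! ### Positive definite sequences are moment sequences -/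

theorem sum_zpow_eq {N : ℕ} {ζ : ℂ} (hζ : IsPrimitiveRoot ζ N) (m : ℤ) :
    ∑ j ∈ Finset.range N, ζ ^ ((j : ℤ) * m) = if (N : ℤ) ∣ m then (N : ℂ) else 0 := by
  have e : ∀ j : ℕ, ζ ^ ((j : ℤ) * m) = (ζ ^ m) ^ j := fun j => by
    rw [mul_comm, zpow_mul, zpow_natCast]
  simp only [e]
  split_ifs with h
  · rw [(hζ.zpow_eq_one_iff_dvd m).2 h]
    simp
  · have h1 : ζ ^ m ≠ 1 := fun h' => h ((hζ.zpow_eq_one_iff_dvd m).1 h')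
    rw [geom_sum_eq h1, ← zpow_natCast, ← zpow_mul, mul_comm, zpow_mul, zpow_natCast, hζ.pow_eq_one]
    simp

/-- The standard `N`-th root of unity. -/
def rootOfUnity (N : ℕ) : Circle := Circle.exp (2 * Real.pi / N)

theorem isPrimitiveRoot_rootOfUnity {N : ℕ} (hN : N ≠ 0) :
    IsPrimitiveRoot (rootOfUnity N : ℂ) N := by
  have := Complex.isPrimitiveRoot_exp N hN
  convert this using 1
  rw [rootOfUnity, Circle.coe_exp]
  congr 1
  push_cast
  ring

section PosDef

variable (G : ℕ → ℂ)

/-- The quadratic form of the sequence on the character `k ↦ ζ^{-jk}`, `k < N`. -/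
def fejerSum (N j : ℕ) : ℂ :=
  ∑ k ∈ Finset.range N, ∑ l ∈ Finset.range N,
    (rootOfUnity N : ℂ) ^ ((j : ℤ) * (k - l)) * hermitianExtend G (l - k)

/-- The sequence is positive definite. -/
def IsPosDefSeq : Prop :=
  ∀ (N : ℕ) (w : ℕ → ℂ), 0 ≤ ∑ k ∈ Finset.range N, ∑ l ∈ Finset.range N,
    star (w k) * w l * hermitianExtend G (l - k)

variable {G}

theorem fejerSum_nonneg (hG : IsPosDefSeq G) (N j : ℕ) : 0 ≤ fejerSum G N j := by
  have h := hG N fun l => (rootOfUnity N : ℂ) ^ (-((j : ℤ) * l))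
  convert h using 1
  refine Finset.sum_congr rfl fun k _ => Finset.sum_congr rfl fun l _ => ?_
  congr 1
  rw [← Circle.coe_zpow, ← Circle.coe_zpow, ← Circle.coe_zpow, Complex.star_def,
    ← Circle.coe_inv_eq_conj, ← zpow_neg, ← Circle.coe_mul, ← zpow_add]
  congr 2
  ring

/-- Discrete Fourier inversion: orthogonality of the characters of ℤ/N keeps only l ≡ k + t mod N,
so each k contributes one term, possibly wrapped around. -/
theorem sum_fejerSum_mul {N : ℕ} (hN : N ≠ 0) (t : ℕ) :
    ∑ j ∈ Finset.range N, fejerSum G N j * (rootOfUnity N : ℂ) ^ ((j : ℤ) * t) =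
      N * ∑ k ∈ Finset.range N, hermitianExtend G (((k + t) % N : ℕ) - k) := by
  have hz : (rootOfUnity N : ℂ) ≠ 0 := Circle.coe_ne_zero _
  have hNpos : 0 < N := Nat.pos_of_ne_zero hN
  simp only [fejerSum, Finset.sum_mul]
  rw [Finset.sum_comm, Finset.mul_sum]
  refine Finset.sum_congr rfl fun k _ => ?_
  rw [Finset.sum_comm]
  have e : ∀ l ∈ Finset.range N, ∑ j ∈ Finset.range N,
      (rootOfUnity N : ℂ) ^ ((j : ℤ) * (k - l)) * hermitianExtend G (l - k) *
        (rootOfUnity N : ℂ) ^ ((j : ℤ) * t) =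
      if l = (k + t) % N then N * hermitianExtend G (l - k) else 0 := by
    intro l hl
    have e1 : ∀ j ∈ Finset.range N, (rootOfUnity N : ℂ) ^ ((j : ℤ) * (k - l)) *
        hermitianExtend G (l - k) * (rootOfUnity N : ℂ) ^ ((j : ℤ) * t) =
        (rootOfUnity N : ℂ) ^ ((j : ℤ) * ((k : ℤ) + t - l)) * hermitianExtend G (l - k) := by
      intro j _
      rw [mul_right_comm, ← zpow_add₀ hz]
      congr 2
      ring
    rw [Finset.sum_congr rfl e1, ← Finset.sum_mul, sum_zpow_eq (isPrimitiveRoot_rootOfUnity hN)]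
    have hiff : (N : ℤ) ∣ (k : ℤ) + t - l ↔ l = (k + t) % N := by
      have h1 := Int.natCast_modEq_iff (a := l) (b := k + t) (n := N)
      rw [Int.modEq_iff_dvd, Nat.ModEq, Nat.mod_eq_of_lt (Finset.mem_range.1 hl)] at h1
      rw [← h1]
      push_cast
      rfl
    by_cases h : l = (k + t) % N
    · rw [if_pos h, if_pos (hiff.2 h)]
    · rw [if_neg h, if_neg fun h' => h (hiff.1 h'), zero_mul]
  rw [Finset.sum_congr rfl e, Finset.sum_ite_eq', if_pos (Finset.mem_range.2 (Nat.mod_lt _ hNpos))]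

theorem hermitianExtend_natCast (t : ℕ) : hermitianExtend G t = G t := by
  simp [hermitianExtend]

/-- The weights of the approximating measures on the roots of unity. -/
def fejerWeight (G : ℕ → ℂ) (N j : ℕ) : ℝ := (fejerSum G N j).re / (N : ℝ) ^ 2

theorem fejerWeight_nonneg (hG : IsPosDefSeq G) (N j : ℕ) : 0 ≤ fejerWeight G N j :=
  div_nonneg (Complex.le_def.1 (fejerSum_nonneg hG N j)).1 (by positivity)

theorem sum_fejerWeight_mul (hG : IsPosDefSeq G) {N : ℕ} (hN : N ≠ 0) (t : ℕ) :
    ∑ j ∈ Finset.range N, (fejerWeight G N j : ℂ) * ((rootOfUnity N : ℂ) ^ j) ^ t =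
      (∑ k ∈ Finset.range N, hermitianExtend G (((k + t) % N : ℕ) - k)) / N := by
  have hN' : (N : ℂ) ≠ 0 := by exact_mod_cast hN
  have e : ∀ j ∈ Finset.range N, (fejerWeight G N j : ℂ) * ((rootOfUnity N : ℂ) ^ j) ^ t =
      (fejerSum G N j * (rootOfUnity N : ℂ) ^ ((j : ℤ) * t)) / (N : ℂ) ^ 2 := by
    intro j _
    have h1 : ((fejerSum G N j).re : ℂ) = fejerSum G N j :=
      (Complex.eq_re_of_ofReal_le (r := 0) (by simpa using fejerSum_nonneg hG N j)).symm
    rw [fejerWeight]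
    push_cast
    rw [h1, ← pow_mul, ← Nat.cast_mul, zpow_natCast]
    ring
  rw [Finset.sum_congr rfl e, ← Finset.sum_div, sum_fejerSum_mul hN]
  field_simp

/-- The approximating measure on the `N`-th roots of unity. -/
def fejerMeasure (G : ℕ → ℂ) (N : ℕ) : Measure Circle :=
  ∑ j ∈ Finset.range N, ENNReal.ofReal (fejerWeight G N j) • Measure.dirac (rootOfUnity N ^ j)

theorem isProbabilityMeasure_fejerMeasure (hG : IsPosDefSeq G) (hG0 : G 0 = 1) {N : ℕ}
    (hN : N ≠ 0) : IsProbabilityMeasure (fejerMeasure G N) := by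
  have h := sum_fejerWeight_mul hG hN 0
  have e : ∀ k ∈ Finset.range N, hermitianExtend G (((k + 0) % N : ℕ) - k) = 1 := by
    intro k hk
    rw [add_zero, Nat.mod_eq_of_lt (Finset.mem_range.1 hk), sub_self]
    simpa [hG0] using hermitianExtend_natCast (G := G) 0
  rw [Finset.sum_congr rfl e] at h
  have hN' : (N : ℂ) ≠ 0 := by exact_mod_cast hN
  simp only [pow_zero, mul_one, Finset.sum_const, Finset.card_range, nsmul_eq_mul,
    div_self hN'] at h
  have h' : ∑ j ∈ Finset.range N, fejerWeight G N j = 1 := by exact_mod_cast h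
  constructor
  simp only [fejerMeasure, Measure.coe_finsetSum, Finset.sum_apply, Measure.smul_apply,
    measure_univ, smul_eq_mul, mul_one]
  rw [← ENNReal.ofReal_sum_of_nonneg fun j _ => fejerWeight_nonneg hG N j, h', ENNReal.ofReal_one]

theorem integral_fejerMeasure (hG : IsPosDefSeq G) {N : ℕ} (hN : N ≠ 0) (t : ℕ) :
    ∫ z : Circle, (z : ℂ) ^ t ∂fejerMeasure G N =
      (∑ k ∈ Finset.range N, hermitianExtend G (((k + t) % N : ℕ) - k)) / N := by
  rw [← sum_fejerWeight_mul hG hN, fejerMeasure, integral_finsetSum_measure]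
  · refine Finset.sum_congr rfl fun j _ => ?_
    rw [integral_smul_measure, integral_dirac, ENNReal.toReal_ofReal (fejerWeight_nonneg hG N j)]
    simp
  · intro j _
    exact (integrable_of_continuous_circle (continuous_induced_dom.pow t) _).smul_measure
      ENNReal.ofReal_ne_top

/-- The moment is an average over k < N whose terms equal G(t) unless k + t wraps past N. At most t
indices wrap, each with error at most 2C. -/
theorem norm_integral_fejerMeasure_sub_le (hG : IsPosDefSeq G) {C : ℝ} (hC : ∀ t, ‖G t‖ ≤ C)
    {N : ℕ} (hN : N ≠ 0) (t : ℕ) :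
    ‖∫ z : Circle, (z : ℂ) ^ t ∂fejerMeasure G N - G t‖ ≤ 2 * C * t / N := by
  have hN' : (N : ℂ) ≠ 0 := by exact_mod_cast hN
  have hC0 : 0 ≤ C := (norm_nonneg _).trans (hC 0)
  have hH : ∀ n, ‖hermitianExtend G n‖ ≤ C := by
    intro n
    rw [hermitianExtend]
    split_ifs
    · exact hC _
    · rw [norm_star]; exact hC _
  have e : ∫ z : Circle, (z : ℂ) ^ t ∂fejerMeasure G N - G t =
      (∑ k ∈ Finset.range N, (hermitianExtend G (((k + t) % N : ℕ) - k) - G t)) / N := by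
    rw [integral_fejerMeasure hG hN, Finset.sum_sub_distrib, sub_div]
    simp [hN']
  rw [e, norm_div, Complex.norm_natCast]
  gcongr
  have hb : ∀ k ∈ Finset.range N, ‖hermitianExtend G (((k + t) % N : ℕ) - k) - G t‖ ≤
      if N ≤ k + t then 2 * C else 0 := by
    intro k _
    split_ifs with h
    · refine (norm_sub_le _ _).trans ?_
      have := hH (((k + t) % N : ℕ) - k)
      have := hC t
      linarith
    · rw [Nat.mod_eq_of_lt (not_le.1 h), show (((k + t : ℕ) : ℤ) - k) = (t : ℕ) by push_cast; ring,
        hermitianExtend_natCast, sub_self, norm_zero]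
  refine (norm_sum_le _ _).trans ((Finset.sum_le_sum hb).trans ?_)
  rw [← Finset.sum_filter, Finset.sum_const, nsmul_eq_mul, mul_comm]
  refine mul_le_mul_of_nonneg_left ?_ (by positivity)
  have hsub : (Finset.range N).filter (fun k => N ≤ k + t) ⊆ Finset.Ico (N - t) N := by
    intro k hk
    simp only [Finset.mem_filter, Finset.mem_range, Finset.mem_Ico] at hk ⊢
    omega
  have := Finset.card_le_card hsub
  rw [Nat.card_Ico] at this
  exact_mod_cast this.trans (by omega)

/-- **Herglotz' theorem**: a normalized bounded positive definite sequence is the moment sequence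
of a probability measure on the circle. -/
theorem exists_moment_eq (hG : IsPosDefSeq G) (hG0 : G 0 = 1) {C : ℝ} (hC : ∀ t, ‖G t‖ ≤ C) :
    ∃ μ : ProbabilityMeasure Circle, ∀ t, moment μ t = G t := by
  let ν : ℕ → ProbabilityMeasure Circle := fun N =>
    ⟨fejerMeasure G (N + 1), isProbabilityMeasure_fejerMeasure hG hG0 N.succ_ne_zero⟩
  -- The probability measures on the circle form a compact space; an ultrafilter limit serves as a
  -- cluster point, with no need to extract a subsequence.
  let U : Ultrafilter ℕ := Ultrafilter.of Filter.atTop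
  obtain ⟨μ, -, hμ⟩ := isCompact_univ.ultrafilter_le_nhds (U.map ν) (by simp)
  refine ⟨μ, fun t => ?_⟩
  have h1 : Filter.Tendsto (fun N => moment (ν N) t) U (nhds (moment μ t)) :=
    ((continuous_moment t).tendsto μ).comp hμ
  have h2 : Filter.Tendsto (fun N => moment (ν N) t) Filter.atTop (nhds (G t)) := by
    rw [tendsto_iff_norm_sub_tendsto_zero]
    refine squeeze_zero (fun N => norm_nonneg _)
      (fun N => norm_integral_fejerMeasure_sub_le hG hC N.succ_ne_zero t) ?_
    exact tendsto_const_nhds.div_atTop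
      (tendsto_natCast_atTop_atTop.comp (Filter.tendsto_add_atTop_nat 1))
  exact tendsto_nhds_unique h1 (h2.mono_left (Ultrafilter.of_le _))

end PosDef

/-! ### The parametrization of the KMS states -/

theorem kmsStates_ext {c d : ℕ} (hc : 0 < c) (hd : 0 < d) {β : ℝ} (hβ : Real.log d < β)
    {φ φ' : KMSStates c d β}
    (h : ∀ t : ℕ, φ.1 (T c d (bP c d ^ t)) = φ'.1 (T c d (bP c d ^ t))) : φ = φ' :=
  Subtype.ext (IsTwistedTrace.ext hc hd (pos_of_log_lt hβ) φ.2.1 φ'.2.1 φ.2.isTwistedTrace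
    φ'.2.isTwistedTrace h)

section Param

variable {c d : ℕ} (hc : 0 < c) (hd : 0 < d) {β : ℝ} (hβ : Real.log d < β)

/-- The KMS state attached to a probability measure on the circle. -/
def kmsState (μ : ProbabilityMeasure Circle) : KMSStates c d β :=
  ⟨measState hc hd hβ μ, (isTwistedTrace_measState hc hd hβ μ).isKMS hc hd (pos_of_log_lt hβ)
    (isState_measState hc hd hβ μ)⟩

theorem kmsState_apply_pow (μ : ProbabilityMeasure Circle) (t : ℕ) :
    (kmsState hc hd hβ μ).1 (T c d (bP c d ^ t)) = (1 - Real.exp (-β) * d) *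
      (moment μ t + ∑' k : indexSet c d t, momentTerm c d β μ t k) :=
  (isTwistedTrace_measState hc hd hβ μ).apply_pow_eq hc hd hβ μ
    (measState_pow_mul_defect hc hd hβ μ) t

theorem hermitianExtend_smul (k : ℝ) (G : ℕ → ℂ) (n : ℤ) :
    hermitianExtend (fun t => (k : ℂ) * G t) n = k * hermitianExtend G n := by
  unfold hermitianExtend
  split_ifs
  · rfl
  · rw [StarMul.star_mul, mul_comm]
    congr 1
    exact Complex.conj_ofReal k

/-- Herglotz applies to φ(T_{b^t} Q) divided by 1 - e^{-β} d. The state of the resulting μ and φ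
have the same values on the T_{b^t}, hence coincide. -/
theorem kmsState_surjective : Function.Surjective (kmsState (c := c) hc hd hβ) := by
  intro φ
  have hr : 0 < 1 - Real.exp (-β) * d := sub_pos.2 (exp_mul_lt_one hd hβ)
  have hr' : (1 - Real.exp (-β) * d : ℂ) ≠ 0 := by exact_mod_cast hr.ne'
  have hinv : (((1 - Real.exp (-β) * d)⁻¹ : ℝ) : ℂ) = (1 - Real.exp (-β) * d : ℂ)⁻¹ := by
    simp only [Complex.ofReal_inv, Complex.ofReal_sub, Complex.ofReal_one, Complex.ofReal_mul,
      Complex.ofReal_natCast]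
  have ht := φ.2.isTwistedTrace
  let G : ℕ → ℂ := fun t =>
    ((1 - Real.exp (-β) * d)⁻¹ : ℝ) * φ.1 (T c d (bP c d ^ t) * defect c d)
  have hpos : IsPosDefSeq G := by
    intro N w
    have h := ht.posDef hc hd φ.2.1 N w
    have e : ∑ k ∈ Finset.range N, ∑ l ∈ Finset.range N,
        star (w k) * w l * hermitianExtend G (l - k) =
        ((1 - Real.exp (-β) * d)⁻¹ : ℝ) * ∑ k ∈ Finset.range N, ∑ l ∈ Finset.range N,
          star (w k) * w l *
            hermitianExtend (fun t => φ.1 (T c d (bP c d ^ t) * defect c d)) (l - k) := by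
      simp only [Finset.mul_sum]
      refine Finset.sum_congr rfl fun k _ => Finset.sum_congr rfl fun l _ => ?_
      rw [hermitianExtend_smul, mul_left_comm]
    rw [e]
    exact mul_nonneg (Complex.zero_le_real.2 (inv_nonneg.2 hr.le)) h
  have hG0 : G 0 = 1 := by
    -- At t = 0 the recursion reads 1 = φ(Q) + e^{-β} d, which gives the normalization.
    have h := ht.recursion hc hd 0
    simp only [pow_zero, map_one, φ.2.1.2, dvd_zero, if_true, Nat.zero_div, mul_zero,
      mul_one] at h
    have h' : φ.1 (T c d (bP c d ^ 0) * defect c d) = 1 - Real.exp (-β) * d := by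
      simp only [pow_zero, map_one]
      linear_combination -h
    change ((1 - Real.exp (-β) * d)⁻¹ : ℝ) * φ.1 (T c d (bP c d ^ 0) * defect c d) = 1
    rw [h', hinv]
    exact inv_mul_cancel₀ hr'
  obtain ⟨C, hC0, hC⟩ := exists_norm_apply_le φ.1
  obtain ⟨μ, hμ⟩ := exists_moment_eq hpos hG0 (C := (1 - Real.exp (-β) * d)⁻¹ * (C * ‖defect c d‖))
    (fun t => by
      change ‖(((1 - Real.exp (-β) * d)⁻¹ : ℝ) : ℂ) * _‖ ≤ _
      rw [norm_mul, Complex.norm_real, Real.norm_of_nonneg (inv_nonneg.2 hr.le)]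
      refine mul_le_mul_of_nonneg_left ((hC _).trans ?_) (inv_nonneg.2 hr.le)
      refine mul_le_mul_of_nonneg_left ((norm_mul_le _ _).trans ?_) hC0
      exact mul_le_of_le_one_left (norm_nonneg _) (norm_T_le c d _))
  refine ⟨μ, kmsStates_ext hc hd hβ fun t => ?_⟩
  rw [kmsState_apply_pow, ht.apply_pow_eq hc hd hβ μ fun t => ?_]
  rw [hμ]
  change _ = (1 - Real.exp (-β) * d : ℂ) * (((1 - Real.exp (-β) * d)⁻¹ : ℝ) * _)
  rw [hinv, mul_inv_cancel_left₀ hr']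

/-- The values on T_{b^t} Q return the moments of μ up to the nonzero factor 1 - e^{-β} d. -/
theorem kmsState_injective : Function.Injective (kmsState (c := c) hc hd hβ) := by
  intro μ ν h
  have hr : 0 < 1 - Real.exp (-β) * d := sub_pos.2 (exp_mul_lt_one hd hβ)
  have hr' : (1 - Real.exp (-β) * d : ℂ) ≠ 0 := by exact_mod_cast hr.ne'
  refine ext_of_moment fun t => mul_left_cancel₀ hr' ?_
  rw [← measState_pow_mul_defect hc hd hβ, ← measState_pow_mul_defect hc hd hβ]
  exact congrArg (fun φ : KMSStates c d β => φ.1 (T c d (bP c d ^ t) * defect c d)) h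

theorem continuous_kmsState : Continuous (kmsState (c := c) hc hd hβ) :=
  Continuous.subtype_mk (WeakDual.continuous_of_continuous_eval fun X =>
    continuous_integral_probabilityMeasure (continuous_pointState hc hd hβ X)) _

/-- A continuous bijection from the compact space of probability measures to a Hausdorff space is a
homeomorphism. -/
theorem isHomeomorph_kmsState : IsHomeomorph (kmsState (c := c) hc hd hβ) :=
  isHomeomorph_iff_continuous_bijective.2 ⟨continuous_kmsState hc hd hβ,
    kmsState_injective hc hd hβ, kmsState_surjective hc hd hβ⟩

theorem kmsState_affine (μ ν ρ : ProbabilityMeasure Circle) (s t : ℝ≥0)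
    (h : (ρ : Measure Circle) = s • (μ : Measure Circle) + t • (ν : Measure Circle)) :
    (kmsState (c := c) hc hd hβ ρ).1 = ((s : ℝ) : ℂ) • (kmsState hc hd hβ μ).1 +
      ((t : ℝ) : ℂ) • (kmsState hc hd hβ ν).1 := by
  refine DFunLike.ext _ _ fun X => ?_
  change ∫ z, pointState hc hd hβ z X ∂(ρ : Measure Circle) =
    ((s : ℝ) : ℂ) • ∫ z, pointState hc hd hβ z X ∂(μ : Measure Circle) +
      ((t : ℝ) : ℂ) • ∫ z, pointState hc hd hβ z X ∂(ν : Measure Circle)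
  rw [h, integral_add_measure ((integrable_pointState hc hd hβ μ X).smul_measure_nnreal)
    ((integrable_pointState hc hd hβ ν X).smul_measure_nnreal), integral_smul_nnreal_measure,
    integral_smul_nnreal_measure]
  rfl

end Param

end

end BaumslagSolitar

open BaumslagSolitar in
theorem theorem5p1 (c d : ℕ) (hc : 0 < c) (hd : 0 < d) (β : ℝ) (hβ : Real.log d < β) :
    ∃ ψ : ProbabilityMeasure Circle → KMSStates c d β,
      -- the value of `ψ_{β,μ}` on `T_{b^t}`, the series being absolutely convergent
      (∀ (μ : ProbabilityMeasure Circle) (t : ℕ),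
        Summable (fun k : indexSet c d t => momentTerm c d β μ t k) ∧
        (ψ μ).1 (T c d (bP c d ^ t)) =
          (1 - Real.exp (-β) * d) *
            (moment μ t + ∑' k : indexSet c d t, momentTerm c d β μ t k)) ∧
      -- a KMS state is determined by its values on the `T_{b^t}`
      (∀ φ φ' : KMSStates c d β,
        (∀ t : ℕ, φ.1 (T c d (bP c d ^ t)) = φ'.1 (T c d (bP c d ^ t))) → φ = φ') ∧
      -- every KMS state has this form
      (∀ φ : KMSStates c d β, ∃ μ : ProbabilityMeasure Circle, φ = ψ μ) ∧
      -- if `d ∤ c`, then `μ ↦ ψ_{β,μ}` is an affine homeomorphism for the weak-star topologies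
      (¬ d ∣ c →
        (∀ (μ ν ρ : ProbabilityMeasure Circle) (s t : ℝ≥0), s + t = 1 →
          (ρ : Measure Circle) = s • (μ : Measure Circle) + t • (ν : Measure Circle) →
          (ψ ρ).1 = ((s : ℝ) : ℂ) • (ψ μ).1 + ((t : ℝ) : ℂ) • (ψ ν).1) ∧
        IsHomeomorph ψ) := by
  refine ⟨kmsState hc hd hβ, fun μ t => ⟨?_, kmsState_apply_pow hc hd hβ μ t⟩,
    fun φ φ' h => kmsStates_ext hc hd hβ h,
    fun φ => (kmsState_surjective hc hd hβ φ).imp fun μ h => h.symm,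
    fun _ => ⟨fun μ ν ρ s t _ h => kmsState_affine hc hd hβ μ ν ρ s t h,
      isHomeomorph_kmsState hc hd hβ⟩⟩
  exact (summable_momentTerm μ hd hβ t).subtype _
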